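/- Let $n\ge 1$ be an integer and $\alpha,\beta>0$. For $t\ge 0$ let $w(x;t)=x^{\alpha}(1-x)^{\beta}e^{-t/x}$ on $(0,1)$, let $D_n(t)=\det\big(\int_0^1 x^{j+k}w(x;t)\,dx\big)_{j,k=0}^{n-1}$ (which is positive), let $P_m(x;t)$ be the monic polynomial of degree $m$ orthogonal to all polynomials of lower degree with respect to $w(\cdot;t)$, and let $h_m(t)=\int_0^1P_m(x;t)^2w(x;t)\,dx$. Put $$R_n(t)=\frac{\beta}{h_n(t)}\int_0^1\frac{P_n(x;t)^2w(x;t)}{1-x}\,dx,\qquad r_n^{*}(t)=\frac{t}{h_{n-1}(t)}\int_0^1\frac{P_n(x;t)P_{n-1}(x;t)w(x;t)}{x}\,dx,$$ $$y(t)=\frac{R_n(t)}{2n+1+\alpha+\beta},\qquad H_n(t)=t\frac{d}{dt}\ln\frac{D_n(t)}{D_n(0)}.$$ Then the following hold. 1. $y$ is a $\mathrm{P_V}\big((2n+1+\alpha+\beta)^2/2,-\beta^2/2,\alpha,-1/2\big)$ transcendent: for all $t>0$, $y(t)\notin\{0,1\}$, $y$ is twice differentiable at $t$, and $$y''=\frac{3y-1}{2y(y-1)}(y')^2-\frac{y'}{t}+\frac{(2n+1+\alpha+\beta)^2(y-1)^2y}{2t^2}-\frac{(y-1)^2\beta^2}{2t^2y}+\frac{\alpha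 y}{t}-\frac{y(y+1)}{2(y-1)};$$ moreover $y(0)=1$ and $y(t)\to1$ as $t\to0^+$. 2. $D_n$ is differentiable on $(0,\infty)$ and, for all $t>0$, $$\begin{aligned}H_n(t)={}&-\frac{1}{4y(y-1)^2}\Big[\beta^2+2y^3-2(2n+\alpha+\beta)^2y^3-2(t+\beta)(2n+\alpha+\beta)y^3-y^4-t^2y'^2+(2n+\alpha+\beta)^2y^4\\&-4n(t+\beta)y-2\beta(t+\alpha+2\beta)y-2ty'y+2ty'y^2+4n^2y^2\\&+y^2\big((t+\alpha)^2+4t\beta+6\alpha\beta+6\beta^2-1\big)+4n(2t+\alpha+3\beta)y^2\Big]+n(n+\alpha-t),\end{aligned}$$ with the initial data $H_n(0)=0$, where also $H_n(t)\to0$ as $t\to0^+$. 3. $r_n^*$ is likewise expressed through $y$, $y'$, $t$ and $n$: writing $F(t)$ for the right-hand side of the formula in 2, for all $t>0$, $$r_n^*(t)=\frac{(1-y)\,\big(F(t)-n(n+\alpha-t)\big)}{2n+\alpha+\beta}+\frac12\Big[ty'+(1-y)\big((2n+1+\alpha+\beta)y-\beta\big)+ty\Big].$$ 4. The Hankel determinant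 has an integral representation in terms of this $\mathrm{P_V}$ transcendent: for all $t>0$ the function $s\mapsto F(s)/s$ is integrable on $(0,t)$, and $$D_n(t)=D_n(0)\exp\Big(\int_0^t\frac{F(s)}{s}\,ds\Big).$$ -/

import Mathlib

open Filter Topology

namespace PollaczekJacobi

noncomputable section

/-- The Pollaczek-Jacobi type weight `x ^ α (1 - x) ^ β e ^ (-t / x)` (used for `0 < x < 1`). -/
def weight (α β t x : ℝ) : ℝ :=
  x ^ α * (1 - x) ^ β * Real.exp (-t / x)

/-- The bilinear form `(p, q) ↦ ∫₀¹ p(x) q(x) w(x; t, α, β) dx` on polynomials. -/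
def ip (α β t : ℝ) (p q : Polynomial ℝ) : ℝ :=
  ∫ x in (0 : ℝ)..1, p.eval x * q.eval x * weight α β t x

/-- The Hankel determinant `D_n(t, α, β)` of the moments of the weight. -/
def hankelDet (n : ℕ) (α β t : ℝ) : ℝ :=
  Matrix.det (Matrix.of fun j k : Fin n =>
    ∫ x in (0 : ℝ)..1, x ^ ((j : ℕ) + (k : ℕ)) * weight α β t x)

/-- The monic orthogonal polynomial `P_n(x; t, α, β)` of degree `n` for the weight, obtained from
the monomials by Gram-Schmidt orthogonalization without normalization. -/
def orthoPoly (α β t : ℝ) : ℕ → Polynomial ℝ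
  | n => Polynomial.X ^ n - ∑ j : Fin n,
      Polynomial.C (ip α β t (Polynomial.X ^ n) (orthoPoly α β t j) /
        ip α β t (orthoPoly α β t j) (orthoPoly α β t j)) * orthoPoly α β t j
  termination_by n => n
  decreasing_by all_goals exact j.isLt

/-- The squared norm `h_n = ∫₀¹ P_n(x)² w(x) dx`. -/
def normSq (n : ℕ) (α β t : ℝ) : ℝ :=
  ip α β t (orthoPoly α β t n) (orthoPoly α β t n)

/-- `R_n(t) = (β / h_n) ∫₀¹ P_n(x)² w(x) / (1 - x) dx`. -/
def RFun (n : ℕ) (α β t : ℝ) : ℝ :=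
  β / normSq n α β t *
    ∫ x in (0 : ℝ)..1, (orthoPoly α β t n).eval x ^ 2 * weight α β t x / (1 - x)

/-- `r_n^*(t) = (t / h_{n-1}) ∫₀¹ P_n(x) P_{n-1}(x) w(x) / x dx`, for `n ≥ 1`. -/
def rStar (n : ℕ) (α β t : ℝ) : ℝ :=
  t / normSq (n - 1) α β t *
    ∫ x in (0 : ℝ)..1, (orthoPoly α β t n).eval x * (orthoPoly α β t (n - 1)).eval x *
      weight α β t x / x

/-- `y(t, α, β) = R_n(t) / (2n + 1 + α + β)`. -/
def yFun (n : ℕ) (α β t : ℝ) : ℝ :=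
  RFun n α β t / (2 * n + 1 + α + β)

/-- `H_n(t, α, β) = t d/dt ln (D_n(t, α, β) / D_n(0, α, β))`. -/
def HFun (n : ℕ) (α β t : ℝ) : ℝ :=
  t * deriv (fun s => Real.log (hankelDet n α β s / hankelDet n α β 0)) t

/-- The right-hand side of the expression of `H_n` through `y` and its derivative, as a rational
function of `t`, of the value `u` of `y` and of the value `v` of the derivative of `y`. -/
def HExpr (n : ℕ) (α β t u v : ℝ) : ℝ :=
  -(1 / (4 * u * (u - 1) ^ 2)) *
    (β ^ 2 + 2 * u ^ 3 - 2 * (2 * n + α + β) ^ 2 * u ^ 3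
      - 2 * (t + β) * (2 * n + α + β) * u ^ 3 - u ^ 4 - t ^ 2 * v ^ 2
      + (2 * n + α + β) ^ 2 * u ^ 4 - 4 * n * (t + β) * u - 2 * β * (t + α + 2 * β) * u
      - 2 * t * v * u + 2 * t * v * u ^ 2 + 4 * n ^ 2 * u ^ 2
      + u ^ 2 * ((t + α) ^ 2 + 4 * t * β + 6 * α * β + 6 * β ^ 2 - 1)
      + 4 * n * (2 * t + α + 3 * β) * u ^ 2)
    + n * (n + α - t)

/-- The expression of `r_n^*` as a rational function of `t`, of the value `u` of `y` and of the
value `v` of the derivative of `y`. -/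
def rStarExpr (n : ℕ) (α β t u v : ℝ) : ℝ :=
  (1 - u) * (HExpr n α β t u v - n * (n + α - t)) / (2 * n + α + β)
    + (t * v + (1 - u) * ((2 * n + 1 + α + β) * u - β) + t * u) / 2

/-- The function `f` solves, at every `t > 0`, the fifth Painlevé equation `P_V(a, b, c, d)`;
that `f` avoids the singular values `0` and `1` and is twice differentiable is part of this. -/
def SolvesPV (a b c d : ℝ) (f : ℝ → ℝ) : Prop :=
  ∀ t : ℝ, 0 < t →
    f t ≠ 0 ∧ f t ≠ 1 ∧ DifferentiableAt ℝ f t ∧ DifferentiableAt ℝ (deriv f) t ∧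
    deriv (deriv f) t =
      (1 / (2 * f t) + 1 / (f t - 1)) * deriv f t ^ 2 - deriv f t / t
        + (f t - 1) ^ 2 / t ^ 2 * (a * f t + b / f t)
        + c * f t / t + d * f t * (f t + 1) / (f t - 1)

end

end PollaczekJacobi

open PollaczekJacobi

namespace PollaczekJacobi

noncomputable section

open Polynomial MeasureTheory Set

/-! The weight satisfies w'/w = α/x - β/(1-x) + t/x² and ∂w/∂t = -w/x. Integrating by parts against
products of P_n and P_{n-1} (`moment_derivative`) relates the moments of w, w/x, w/x² and w/(1-x),
and orthogonality reduces each of these to a few unknowns: R_n, its companion S_n = R_n - (2n+1+α+β)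
(`SFun`), r_n^*, its companion r_n (`rFun`, index shifted by one) and the subleading coefficient of
P_n, which equals r_n^* - r_n.

With ρ = r_n^*, the unknowns obey three quadratic identities involving h_n/h_{n-1}
(`rStar_mul_rStar_sub`, `rFun_mul_rFun_add`, `two_mul_rStar_sub_mul`). Eliminating R_{n-1} and
S_{n-1} leaves one relation (`rStar_quadratic_relation`); in terms of G = ρR - rS it becomes linear
in ρ, so ρ and r are rational in R and G.

Differentiation in t gives t h_n' = -S_n h_n, the evolution of P_n (`X_mul_orthoPoly_deriv`) and a
Riccati equation t R' = 2G + S(R-β) - tR (`hasDerivAt_SFun`). Hence G, and with it ρ and r, is a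
function of t, y and y'. Since D_n is the product of the h_j, H_n = -∑ S_j; this sum telescopes to
(2n+α+β)(ρ-r) + n(n+α-t), which yields parts 2 and 3. Differentiating the Riccati equation once
more, with ρ' taken from the identity for h_n/h_{n-1}, yields P_V. Positivity of S_n keeps y above
1. As t tends to 0, S_n tends to 0, which gives the initial data, and part 4 is the integration of
(ln D_n)' = H_n/t. -/

/-! ### Bounds and integrability for the weight. -/

theorem weight_nonneg (α β t : ℝ) {x : ℝ} (h0 : 0 ≤ x) (h1 : x ≤ 1) : 0 ≤ weight α β t x :=
  mul_nonneg (mul_nonneg (Real.rpow_nonneg h0 _) (Real.rpow_nonneg (by linarith) _))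
    (Real.exp_pos _).le

theorem weight_pos (α β t : ℝ) {x : ℝ} (h0 : 0 < x) (h1 : x < 1) : 0 < weight α β t x :=
  mul_pos (mul_pos (Real.rpow_pos_of_pos h0 _) (Real.rpow_pos_of_pos (by linarith) _))
    (Real.exp_pos _)

theorem measurable_weight (α β t : ℝ) : Measurable (weight α β t) := by
  unfold weight; fun_prop

theorem weight_antitone (α β : ℝ) {s t x : ℝ} (hst : s ≤ t) (h0 : 0 < x) (h1 : x ≤ 1) :
    weight α β t x ≤ weight α β s x := by
  refine mul_le_mul_of_nonneg_left (Real.exp_le_exp.2 ?_)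
    (mul_nonneg (Real.rpow_nonneg h0.le _) (Real.rpow_nonneg (by linarith) _))
  gcongr

theorem weight_le_rpow {α β t x : ℝ} (hβ : 0 ≤ β) (ht : 0 ≤ t) (h0 : 0 < x) (h1 : x ≤ 1) :
    weight α β t x ≤ x ^ α := by
  have h2 : (1 - x) ^ β ≤ 1 := Real.rpow_le_one (by linarith) (by linarith) hβ
  have h3 : Real.exp (-t / x) ≤ 1 :=
    Real.exp_le_one_iff.2 (div_nonpos_of_nonpos_of_nonneg (by linarith) h0.le)
  have h4 := Real.rpow_nonneg h0.le α
  unfold weight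
  calc x ^ α * (1 - x) ^ β * Real.exp (-t / x) ≤ x ^ α * 1 * 1 := by
        gcongr
    _ = x ^ α := by ring

theorem weight_le_rpow_one_sub {α β t x : ℝ} (hα : 0 ≤ α) (ht : 0 ≤ t) (h0 : 0 < x) (h1 : x ≤ 1) :
    weight α β t x ≤ (1 - x) ^ β := by
  have h2 : x ^ α ≤ 1 := Real.rpow_le_one h0.le h1 hα
  have h3 : Real.exp (-t / x) ≤ 1 :=
    Real.exp_le_one_iff.2 (div_nonpos_of_nonpos_of_nonneg (by linarith) h0.le)
  have h4 : 0 ≤ (1 - x) ^ β := Real.rpow_nonneg (by linarith) _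
  unfold weight
  calc x ^ α * (1 - x) ^ β * Real.exp (-t / x) ≤ 1 * (1 - x) ^ β * 1 := by
        gcongr
    _ = _ := by ring

/-- For t > 0 the factor e^(-t/x) beats every power of x, because e^u ≥ u^k/k! at u = t/x. -/
theorem weight_le_const_mul_pow {α β t x : ℝ} (hα : 0 ≤ α) (hβ : 0 ≤ β) (ht : 0 < t) (h0 : 0 < x)
    (h1 : x ≤ 1) (k : ℕ) : weight α β t x ≤ k.factorial / t ^ k * x ^ k := by
  have h2 : (1 - x) ^ β ≤ 1 := Real.rpow_le_one (by linarith) (by linarith) hβ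
  have h3 : x ^ α ≤ 1 := Real.rpow_le_one h0.le h1 hα
  have h5 : 0 ≤ (1 - x) ^ β := Real.rpow_nonneg (by linarith) _
  have h4 : Real.exp (-t / x) ≤ k.factorial / t ^ k * x ^ k := by
    have := Real.pow_div_factorial_le_exp (t / x) (by positivity) k
    rw [neg_div, Real.exp_neg, inv_le_comm₀ (Real.exp_pos _) (by positivity)]
    refine le_trans (le_of_eq ?_) this
    rw [div_pow]
    field_simp
  unfold weight
  calc x ^ α * (1 - x) ^ β * Real.exp (-t / x) ≤ 1 * 1 * Real.exp (-t / x) := by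
        gcongr
    _ ≤ _ := by simpa using h4

/-- `w / x ^ k` is integrable when `t > 0`, and also for `t = 0` when `k ≤ 1`. -/
theorem intervalIntegrable_weight_div_pow {α β t : ℝ} (hα : 0 < α) (hβ : 0 < β) {k : ℕ}
    (h : 0 < t ∨ 0 ≤ t ∧ k ≤ 1) :
    IntervalIntegrable (fun x => weight α β t x / x ^ k) volume 0 1 := by
  have hm : AEStronglyMeasurable (fun x => weight α β t x / x ^ k)
      (volume.restrict (uIoc (0 : ℝ) 1)) :=
    ((measurable_weight α β t).div (measurable_id.pow_const k)).aestronglyMeasurable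
  rcases h with ht | ⟨ht, hk⟩
  · refine IntervalIntegrable.mono_fun' (g := fun _ => k.factorial / t ^ k) (by simp) hm ?_
    refine (ae_restrict_iff' measurableSet_uIoc).2 (Eventually.of_forall fun x hx => ?_)
    rw [uIoc_of_le zero_le_one] at hx
    have h0 : 0 < x ^ k := pow_pos hx.1 k
    dsimp only
    rw [Real.norm_of_nonneg (div_nonneg (weight_nonneg _ _ _ hx.1.le hx.2) h0.le),
      div_le_iff₀ h0]
    exact weight_le_const_mul_pow hα.le hβ.le ht hx.1 hx.2 k
  · refine IntervalIntegrable.mono_fun' (g := fun x => x ^ (α - 1))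
      (intervalIntegral.intervalIntegrable_rpow' (by linarith)) hm ?_
    refine (ae_restrict_iff' measurableSet_uIoc).2 (Eventually.of_forall fun x hx => ?_)
    rw [uIoc_of_le zero_le_one] at hx
    have h0 : 0 < x ^ k := pow_pos hx.1 k
    dsimp only
    rw [Real.norm_of_nonneg (div_nonneg (weight_nonneg _ _ _ hx.1.le hx.2) h0.le),
      div_le_iff₀ h0]
    calc weight α β t x ≤ x ^ α := weight_le_rpow hβ.le ht hx.1 hx.2
      _ = x ^ (α - 1) * x ^ 1 := by
        rw [← Real.rpow_natCast, ← Real.rpow_add hx.1]; norm_num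
      _ ≤ x ^ (α - 1) * x ^ k :=
        mul_le_mul_of_nonneg_left (pow_le_pow_of_le_one hx.1.le hx.2 hk)
          (Real.rpow_nonneg hx.1.le _)

theorem intervalIntegrable_weight_div_one_sub {α β t : ℝ} (hα : 0 < α) (hβ : 0 < β) (ht : 0 ≤ t) :
    IntervalIntegrable (fun x => weight α β t x / (1 - x)) volume 0 1 := by
  have hm : AEStronglyMeasurable (fun x => weight α β t x / (1 - x))
      (volume.restrict (uIoc (0 : ℝ) 1)) :=
    ((measurable_weight α β t).div (measurable_id.const_sub 1)).aestronglyMeasurable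
  have hb : IntervalIntegrable (fun x : ℝ => (1 - x) ^ (β - 1)) volume 0 1 := by
    have := (intervalIntegral.intervalIntegrable_rpow' (a := 0) (b := 1)
      (r := β - 1) (by linarith)).comp_sub_left 1
    simpa using this.symm
  refine hb.mono_fun' hm ?_
  refine (ae_restrict_iff' measurableSet_uIoc).2 (Eventually.of_forall fun x hx => ?_)
  rw [uIoc_of_le zero_le_one] at hx
  dsimp only
  rcases eq_or_lt_of_le hx.2 with rfl | h1
  · simp [Real.rpow_nonneg]
  have h0 : 0 < 1 - x := by linarith
  rw [Real.norm_of_nonneg (div_nonneg (weight_nonneg _ _ _ hx.1.le hx.2) h0.le), div_le_iff₀ h0]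
  calc weight α β t x ≤ (1 - x) ^ β := weight_le_rpow_one_sub hα.le ht hx.1 hx.2
    _ = (1 - x) ^ (β - 1) * (1 - x) := by
      nth_rewrite 3 [← Real.rpow_one (1 - x)]
      rw [← Real.rpow_add h0]; norm_num

/-! ### Moments as linear functionals on polynomials. -/

/-- The linear functional `p ↦ ∫₀¹ p(x) w(x) / x ^ k dx`. -/
def originMoment (α β t : ℝ) (k : ℕ) : ℝ[X] →ₗ[ℝ] ℝ :=
  Polynomial.lsum fun i => (∫ x in (0 : ℝ)..1, x ^ i * weight α β t x / x ^ k) • LinearMap.id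

/-- The linear functional `p ↦ ∫₀¹ p(x) w(x) / (1 - x) dx`. -/
def unitMoment (α β t : ℝ) : ℝ[X] →ₗ[ℝ] ℝ :=
  Polynomial.lsum fun i => (∫ x in (0 : ℝ)..1, x ^ i * weight α β t x / (1 - x)) • LinearMap.id

theorem originMoment_X_pow (α β t : ℝ) (k i : ℕ) : originMoment α β t k (X ^ i) =
    ∫ x in (0 : ℝ)..1, x ^ i * weight α β t x / x ^ k := by
  rw [← monomial_one_right_eq_X_pow]
  simp [originMoment, Polynomial.sum_monomial_index]

theorem unitMoment_X_pow (α β t : ℝ) (i : ℕ) : unitMoment α β t (X ^ i) =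
    ∫ x in (0 : ℝ)..1, x ^ i * weight α β t x / (1 - x) := by
  rw [← monomial_one_right_eq_X_pow]
  simp [unitMoment, Polynomial.sum_monomial_index]

theorem linearMap_eq_sum (L : ℝ[X] →ₗ[ℝ] ℝ) (g : ℝ[X]) {d : ℕ} (hd : g.natDegree ≤ d) :
    L g = ∑ i ∈ Finset.range (d + 1), g.coeff i * L (X ^ i) := by
  conv_lhs => rw [g.as_sum_range' (d + 1) (by omega)]
  simp [← C_mul_X_pow_eq_monomial, ← smul_eq_C_mul]

theorem linearMap_ext_X_pow {L M : ℝ[X] →ₗ[ℝ] ℝ} (h : ∀ i, L (X ^ i) = M (X ^ i)) (g : ℝ[X]) :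
    L g = M g := by
  rw [linearMap_eq_sum L g le_rfl, linearMap_eq_sum M g le_rfl]; simp [h]

theorem intervalIntegrable_eval_mul {φ : ℝ → ℝ} (hφ : IntervalIntegrable φ volume 0 1) (g : ℝ[X]) :
    IntervalIntegrable (fun x => g.eval x * φ x) volume 0 1 :=
  hφ.continuousOn_mul g.continuous.continuousOn

theorem linearMap_eq_integral {φ : ℝ → ℝ} (hφ : IntervalIntegrable φ volume 0 1)
    {L : ℝ[X] →ₗ[ℝ] ℝ} (hL : ∀ i, L (X ^ i) = ∫ x in (0 : ℝ)..1, x ^ i * φ x) (g : ℝ[X]) :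
    L g = ∫ x in (0 : ℝ)..1, g.eval x * φ x := by
  rw [linearMap_eq_sum L g le_rfl]
  simp_rw [hL, eval_eq_sum_range, Finset.sum_mul]
  rw [intervalIntegral.integral_finsetSum]
  · refine Finset.sum_congr rfl fun i _ => ?_
    rw [← intervalIntegral.integral_const_mul]
    congr 1; ext x; ring
  · intro i _
    have := (intervalIntegrable_eval_mul hφ (X ^ i)).const_mul (g.coeff i)
    simpa [mul_assoc] using this

/-- The functional is linear by construction, being prescribed on monomials; integrability is needed
only to identify it with an integral. -/
theorem originMoment_eq_integral {α β t : ℝ} (hα : 0 < α) (hβ : 0 < β) {k : ℕ}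
    (h : 0 < t ∨ 0 ≤ t ∧ k ≤ 1) (g : ℝ[X]) :
    originMoment α β t k g = ∫ x in (0 : ℝ)..1, g.eval x * weight α β t x / x ^ k := by
  simp_rw [mul_div_assoc]
  exact linearMap_eq_integral (intervalIntegrable_weight_div_pow hα hβ h)
    (fun i => by simp_rw [originMoment_X_pow, mul_div_assoc]) g

theorem unitMoment_eq_integral {α β t : ℝ} (hα : 0 < α) (hβ : 0 < β)
    (ht : 0 ≤ t) (g : ℝ[X]) :
    unitMoment α β t g = ∫ x in (0 : ℝ)..1, g.eval x * weight α β t x / (1 - x) := by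
  simp_rw [mul_div_assoc]
  exact linearMap_eq_integral (intervalIntegrable_weight_div_one_sub hα hβ ht)
    (fun i => by simp_rw [unitMoment_X_pow, mul_div_assoc]) g

theorem originMoment_succ_X_mul (α β t : ℝ) (k : ℕ) (g : ℝ[X]) :
    originMoment α β t (k + 1) (X * g) = originMoment α β t k g := by
  refine linearMap_ext_X_pow (L := originMoment α β t (k + 1) ∘ₗ LinearMap.mulLeft ℝ X)
    (fun i => ?_) g
  simp only [LinearMap.comp_apply, LinearMap.mulLeft_apply, ← pow_succ', originMoment_X_pow]
  refine intervalIntegral.integral_congr_ae (Eventually.of_forall fun x hx => ?_)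
  rw [uIoc_of_le zero_le_one] at hx
  have := hx.1.ne'
  field_simp
  ring

theorem ae_ne_one : ∀ᵐ x : ℝ, x ≠ 1 := by
  simp [ae_iff, measure_singleton]

theorem unitMoment_one_sub_X_mul {α β t : ℝ} (hα : 0 < α) (hβ : 0 < β) (ht : 0 ≤ t) (g : ℝ[X]) :
    unitMoment α β t ((1 - X) * g) = originMoment α β t 0 g := by
  rw [unitMoment_eq_integral hα hβ ht, originMoment_eq_integral hα hβ (Or.inr ⟨ht, zero_le_one⟩)]
  refine intervalIntegral.integral_congr_ae (ae_ne_one.mono fun x hx _ => ?_)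
  have : 1 - x ≠ 0 := sub_ne_zero.2 hx.symm
  simp only [eval_mul, eval_sub, eval_one, eval_X, pow_zero, div_one]
  field_simp

theorem integral_polynomial_pos {φ : ℝ → ℝ} (hφ : IntervalIntegrable φ volume 0 1)
    (hpos : ∀ x, 0 < x → x < 1 → 0 < φ x) {g : ℝ[X]} (hg : g ≠ 0) :
    0 < ∫ x in (0 : ℝ)..1, (g * g).eval x * φ x := by
  have hi := intervalIntegrable_eval_mul hφ (g * g)
  have hnn : 0 ≤ᵐ[volume.restrict (uIoc (0 : ℝ) 1)] fun x => (g * g).eval x * φ x := by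
    rw [uIoc_of_le zero_le_one]
    refine (ae_restrict_iff' measurableSet_Ioc).2 (ae_ne_one.mono fun x h1 hx => ?_)
    simp only [Pi.zero_apply, eval_mul]
    exact mul_nonneg (mul_self_nonneg _) (hpos x hx.1 (lt_of_le_of_ne hx.2 h1)).le
  rw [intervalIntegral.integral_pos_iff_support_of_nonneg_ae' hnn hi]
  refine ⟨zero_lt_one, ?_⟩
  -- The integrand is nonzero off the finite root set of g, hence on a set of full measure in (0,
  -- 1).
  have hsub : Ioo (0 : ℝ) 1 \ ↑g.roots.toFinset ⊆
      Function.support (fun x => (g * g).eval x * φ x) ∩ Ioc 0 1 := by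
    rintro x ⟨hx, hr⟩
    refine ⟨?_, hx.1, hx.2.le⟩
    have : g.eval x ≠ 0 := by
      intro h; apply hr; simp [hg, h]
    simp only [Function.mem_support, eval_mul]
    exact mul_ne_zero (mul_ne_zero this this) (hpos x hx.1 hx.2).ne'
  refine lt_of_lt_of_le ?_ (measure_mono hsub)
  rw [measure_sdiff_null (Finset.measure_zero _ _)]
  simp

theorem originMoment_mul_self_pos {α β t : ℝ} (hα : 0 < α) (hβ : 0 < β) {k : ℕ}
    (h : 0 < t ∨ 0 ≤ t ∧ k ≤ 1) {g : ℝ[X]} (hg : g ≠ 0) :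
    0 < originMoment α β t k (g * g) := by
  rw [originMoment_eq_integral hα hβ h]
  simp_rw [mul_div_assoc]
  exact integral_polynomial_pos (intervalIntegrable_weight_div_pow hα hβ h)
    (fun x h0 h1 => div_pos (weight_pos _ _ _ h0 h1) (pow_pos h0 k)) hg

/-! ### Logarithmic derivative of the weight and integration by parts. -/

theorem continuousOn_weight {α β t : ℝ} (hα : 0 < α) (hβ : 0 < β) (ht : 0 ≤ t) :
    ContinuousOn (weight α β t) (Icc 0 1) := by
  intro x hx
  rcases eq_or_lt_of_le hx.1 with rfl | h0
  · have hz : weight α β t 0 = 0 := by simp [weight, Real.zero_rpow hα.ne']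
    rw [ContinuousWithinAt, hz]
    have hc : Tendsto (fun x : ℝ => x ^ α) (𝓝[Icc 0 1] 0) (𝓝 0) := by
      have := (Real.continuousAt_rpow_const 0 α (Or.inr hα.le)).tendsto
      rw [Real.zero_rpow hα.ne'] at this
      exact this.mono_left nhdsWithin_le_nhds
    refine squeeze_zero' ?_ ?_ hc
    · filter_upwards [self_mem_nhdsWithin] with y hy using weight_nonneg _ _ _ hy.1 hy.2
    · filter_upwards [self_mem_nhdsWithin] with y hy
      rcases eq_or_lt_of_le hy.1 with rfl | hy0
      · rw [hz, Real.zero_rpow hα.ne']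
      · exact weight_le_rpow hβ.le ht hy0 hy.2
  · refine ContinuousAt.continuousWithinAt ?_
    have h1 : ContinuousAt (fun x : ℝ => x ^ α) x :=
      Real.continuousAt_rpow_const _ _ (Or.inr hα.le)
    have h2 : ContinuousAt (fun x : ℝ => (1 - x) ^ β) x :=
      (continuousAt_const.sub continuousAt_id).rpow_const (Or.inr hβ.le)
    have h3 : ContinuousAt (fun x : ℝ => Real.exp (-t / x)) x :=
      (continuousAt_const.div continuousAt_id h0.ne').rexp
    exact (h1.mul h2).mul h3

theorem hasDerivAt_weight (α β t : ℝ) {x : ℝ} (h0 : 0 < x) (h1 : x < 1) :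
    HasDerivAt (weight α β t) ((α / x - β / (1 - x) + t / x ^ 2) * weight α β t x) x := by
  have h1' : 0 < 1 - x := by linarith
  have d1 : HasDerivAt (fun x : ℝ => x ^ α) (α * x ^ (α - 1)) x :=
    Real.hasDerivAt_rpow_const (Or.inl h0.ne')
  have d2 : HasDerivAt (fun x : ℝ => (1 - x) ^ β) (-1 * β * (1 - x) ^ (β - 1)) x :=
    ((hasDerivAt_id x).const_sub 1).rpow_const (Or.inl h1'.ne')
  have d3 : HasDerivAt (fun x : ℝ => Real.exp (-t / x))
      (Real.exp (-t / x) * (t / x ^ 2)) x := by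
    have : HasDerivAt (fun x : ℝ => -t / x) (t / x ^ 2) x := by
      have := (hasDerivAt_inv h0.ne').const_mul (-t)
      refine this.congr_deriv ?_
      field_simp
    exact this.exp
  refine ((d1.mul d2).mul d3).congr_deriv ?_
  rw [Real.rpow_sub h0, Real.rpow_sub h1', Real.rpow_one, Real.rpow_one]
  simp only [weight, Pi.mul_apply]
  field_simp
  ring

/-- Integration by parts against the weight, which satisfies
`w' = (α / x - β / (1 - x) + t / x ^ 2) w` and vanishes at both ends of the interval. -/
theorem moment_derivative {α β t : ℝ} (hα : 0 < α) (hβ : 0 < β) (ht : 0 ≤ t) (g : ℝ[X]) :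
    originMoment α β t 0 (derivative g) + α * originMoment α β t 1 g - β * unitMoment α β t g
      + t * originMoment α β t 2 g = 0 := by
  -- At t = 0 the function w/x² may fail to be integrable (when α ≤ 1); the factor t is kept inside
  -- the integral so that the term is then zero.
  have e2 : t * originMoment α β t 2 g =
      ∫ x in (0 : ℝ)..1, t * (g.eval x * (weight α β t x / x ^ 2)) := by
    rw [intervalIntegral.integral_const_mul]
    rcases eq_or_lt_of_le ht with rfl | h
    · simp
    · rw [originMoment_eq_integral hα hβ (Or.inl h)]; simp_rw [mul_div_assoc]
  have i2 : IntervalIntegrable (fun x => t * (g.eval x * (weight α β t x / x ^ 2))) volume 0 1 := by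
    rcases eq_or_lt_of_le ht with rfl | h
    · simp
    · exact (intervalIntegrable_eval_mul
        (intervalIntegrable_weight_div_pow hα hβ (Or.inl h)) g).const_mul t
  have i0 := intervalIntegrable_eval_mul
    (intervalIntegrable_weight_div_pow hα hβ (Or.inr ⟨ht, zero_le_one⟩)) (derivative g)
  have i1 := (intervalIntegrable_eval_mul
    (intervalIntegrable_weight_div_pow hα hβ (Or.inr ⟨ht, le_rfl⟩)) g).const_mul α
  have ib := (intervalIntegrable_eval_mul
    (intervalIntegrable_weight_div_one_sub hα hβ ht) g).const_mul β
  have key := intervalIntegral.integral_eq_sub_of_hasDerivAt_of_le (a := 0) (b := 1)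
    (f := fun x => g.eval x * weight α β t x) zero_le_one
    (g.continuous.continuousOn.mul (continuousOn_weight hα hβ ht))
    (fun x hx => by
      have h := (g.hasDerivAt x).mul (hasDerivAt_weight α β t hx.1 hx.2)
      refine h.congr_deriv (g' := (derivative g).eval x * (weight α β t x / x ^ 0)
        + α * (g.eval x * (weight α β t x / x ^ 1))
        - β * (g.eval x * (weight α β t x / (1 - x)))
        + t * (g.eval x * (weight α β t x / x ^ 2))) ?_
      have := hx.1.ne'
      have h1 : 1 - x ≠ 0 := by linarith [hx.2]
      field_simp
      ring)
    (((i0.add i1).sub ib).add i2)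
  rw [intervalIntegral.integral_add ((i0.add i1).sub ib) i2,
    intervalIntegral.integral_sub (i0.add i1) ib, intervalIntegral.integral_add i0 i1,
    intervalIntegral.integral_const_mul, intervalIntegral.integral_const_mul, ← e2] at key
  rw [originMoment_eq_integral hα hβ (Or.inr ⟨ht, zero_le_one⟩),
    originMoment_eq_integral hα hβ (Or.inr ⟨ht, le_rfl⟩), unitMoment_eq_integral hα hβ ht]
  simp_rw [mul_div_assoc]
  rw [key]
  simp [weight, Real.zero_rpow hα.ne', Real.zero_rpow hβ.ne']

/-! ### Dependence of the moments on t. -/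

theorem hasDerivAt_originMoment {α β t : ℝ} (hα : 0 < α) (hβ : 0 < β) (ht : 0 < t) (k : ℕ)
    (g : ℝ[X]) :
    HasDerivAt (fun s => originMoment α β s k g) (-originMoment α β t (k + 1) g) t := by
  have hk : ∀ (k : ℕ) (s : ℝ), AEStronglyMeasurable
      (fun x => g.eval x * (weight α β s x / x ^ k)) (volume.restrict (uIoc (0 : ℝ) 1)) :=
    fun k s => (g.continuous.measurable.mul
      ((measurable_weight α β s).div (measurable_id.pow_const k))).aestronglyMeasurable
  -- The weight decreases in t, so on this neighbourhood its value at t/2 dominates, and w/x^(k+1)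
  -- is still integrable there.
  have hs : Ioi (t / 2) ∈ 𝓝 t := Ioi_mem_nhds (by linarith)
  have key := (intervalIntegral.hasDerivAt_integral_of_dominated_loc_of_deriv_le
    (μ := volume) (a := 0) (b := 1)
    (F := fun s x => g.eval x * (weight α β s x / x ^ k))
    (F' := fun s x => -(g.eval x * (weight α β s x / x ^ (k + 1))))
    (bound := fun x => |g.eval x * (weight α β (t / 2) x / x ^ (k + 1))|)
    (x₀ := t) hs (Eventually.of_forall fun s => hk k s)
    (intervalIntegrable_eval_mul (intervalIntegrable_weight_div_pow hα hβ (Or.inl ht)) g)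
    (hk (k + 1) t).neg ?_ ?_ ?_).2
  · rw [originMoment_eq_integral hα hβ (Or.inl ht), ← intervalIntegral.integral_neg]
    simp_rw [mul_div_assoc]
    refine key.congr_of_eventuallyEq ?_
    filter_upwards [Ioi_mem_nhds ht] with s hs
    rw [originMoment_eq_integral hα hβ (Or.inl hs)]
    simp_rw [mul_div_assoc]
  · refine Eventually.of_forall fun x hx s hs => ?_
    rw [uIoc_of_le zero_le_one] at hx
    rw [norm_neg, Real.norm_eq_abs, abs_mul, abs_mul]
    have h0 := pow_pos hx.1 (k + 1)
    rw [abs_of_nonneg (div_nonneg (weight_nonneg α β s hx.1.le hx.2) h0.le),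
      abs_of_nonneg (div_nonneg (weight_nonneg α β (t / 2) hx.1.le hx.2) h0.le)]
    have := weight_antitone α β (le_of_lt hs) hx.1 hx.2
    gcongr
  · exact (intervalIntegrable_eval_mul (intervalIntegrable_weight_div_pow hα hβ
      (Or.inl (by linarith : 0 < t / 2))) g).abs
  · refine Eventually.of_forall fun x hx s _ => ?_
    rw [uIoc_of_le zero_le_one] at hx
    have d : HasDerivAt (fun s : ℝ => Real.exp (-s / x)) (Real.exp (-s / x) * (-1 / x)) s :=
      ((hasDerivAt_id s).neg.div_const x).exp
    refine (((d.const_mul (x ^ α * (1 - x) ^ β)).div_const (x ^ k)).const_mul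
      (g.eval x)).congr_deriv ?_
    have := hx.1.ne'
    unfold weight
    field_simp
    ring

/-- Continuity up to t = 0, needed for the initial data. The dominating function is the weight at t
= 0, hence the restriction k ≤ 1. -/
theorem continuousOn_originMoment {α β : ℝ} (hα : 0 < α) (hβ : 0 < β) {k : ℕ} (hk : k ≤ 1)
    (g : ℝ[X]) : ContinuousOn (fun s => originMoment α β s k g) (Ici 0) := by
  intro t ht
  have hm : ∀ s : ℝ, AEStronglyMeasurable
      (fun x => g.eval x * (weight α β s x / x ^ k)) (volume.restrict (uIoc (0 : ℝ) 1)) :=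
    fun s => (g.continuous.measurable.mul
      ((measurable_weight α β s).div (measurable_id.pow_const k))).aestronglyMeasurable
  have key := intervalIntegral.continuousWithinAt_of_dominated_interval
    (μ := volume) (a := 0) (b := 1) (s := Ici 0) (x₀ := t)
    (F := fun s x => g.eval x * (weight α β s x / x ^ k))
    (bound := fun x => |g.eval x * (weight α β 0 x / x ^ k)|)
    (Eventually.of_forall fun s => hm s) ?_ ?_ ?_
  · refine key.congr (fun s hs => ?_) ?_
    all_goals
      rw [originMoment_eq_integral hα hβ (Or.inr ⟨by assumption, hk⟩)]
      simp_rw [mul_div_assoc]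
  · filter_upwards [self_mem_nhdsWithin] with s hs
    refine Eventually.of_forall fun x hx => ?_
    rw [uIoc_of_le zero_le_one] at hx
    have h0 := pow_pos hx.1 k
    rw [Real.norm_eq_abs, abs_mul, abs_mul,
      abs_of_nonneg (div_nonneg (weight_nonneg α β s hx.1.le hx.2) h0.le),
      abs_of_nonneg (div_nonneg (weight_nonneg α β 0 hx.1.le hx.2) h0.le)]
    have := weight_antitone α β hs hx.1 hx.2
    gcongr
  · exact (intervalIntegrable_eval_mul (intervalIntegrable_weight_div_pow hα hβ
      (Or.inr ⟨le_rfl, hk⟩)) g).abs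
  · refine Eventually.of_forall fun x _ => ContinuousAt.continuousWithinAt ?_
    unfold weight
    fun_prop

/-! ### Orthogonality. -/

theorem ip_eq {α β t : ℝ} (hα : 0 < α) (hβ : 0 < β) (ht : 0 ≤ t) (p q : ℝ[X]) :
    ip α β t p q = originMoment α β t 0 (p * q) := by
  rw [originMoment_eq_integral hα hβ (Or.inr ⟨ht, zero_le_one⟩)]
  simp [ip]

theorem orthoPoly_eq (α β t : ℝ) (n : ℕ) : orthoPoly α β t n = X ^ n - ∑ j ∈ Finset.range n,
    C (ip α β t (X ^ n) (orthoPoly α β t j) / ip α β t (orthoPoly α β t j) (orthoPoly α β t j)) *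
      orthoPoly α β t j := by
  rw [orthoPoly, Finset.sum_range]

theorem orthoPoly_monic_and_natDegree (α β t : ℝ) (n : ℕ) :
    (orthoPoly α β t n).Monic ∧ (orthoPoly α β t n).natDegree = n := by
  induction n using Nat.strong_induction_on with
  | _ n ih =>
    have hd : degree (∑ j ∈ Finset.range n, C (ip α β t (X ^ n) (orthoPoly α β t j) /
        ip α β t (orthoPoly α β t j) (orthoPoly α β t j)) * orthoPoly α β t j) < n := by
      rw [← mem_degreeLT]
      refine Submodule.sum_mem _ fun j hj => ?_
      rw [← smul_eq_C_mul]
      refine Submodule.smul_mem _ _ (mem_degreeLT.2 ?_)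
      have hj := Finset.mem_range.1 hj
      rw [degree_eq_natDegree (ih j hj).1.ne_zero, (ih j hj).2]
      exact_mod_cast hj
    have hm : (orthoPoly α β t n).Monic := by
      rw [orthoPoly_eq]
      exact (monic_X_pow n).sub_of_left (by simpa using hd)
    refine ⟨hm, ?_⟩
    apply natDegree_eq_of_degree_eq_some
    rw [orthoPoly_eq, degree_sub_eq_left_of_degree_lt (by simpa using hd), degree_X_pow]

theorem orthoPoly_monic (α β t : ℝ) (n : ℕ) : (orthoPoly α β t n).Monic :=
  (orthoPoly_monic_and_natDegree α β t n).1

@[simp]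
theorem natDegree_orthoPoly (α β t : ℝ) (n : ℕ) : (orthoPoly α β t n).natDegree = n :=
  (orthoPoly_monic_and_natDegree α β t n).2

@[simp]
theorem coeff_orthoPoly_self (α β t : ℝ) (n : ℕ) : (orthoPoly α β t n).coeff n = 1 := by
  simpa using (orthoPoly_monic α β t n).coeff_natDegree

theorem coeff_orthoPoly_of_lt (α β t : ℝ) {n k : ℕ} (h : n < k) : (orthoPoly α β t n).coeff k = 0 :=
  coeff_eq_zero_of_natDegree_lt (by simpa using h)

theorem normSq_eq {α β t : ℝ} (hα : 0 < α) (hβ : 0 < β) (ht : 0 ≤ t) (n : ℕ) :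
    normSq n α β t = originMoment α β t 0 (orthoPoly α β t n * orthoPoly α β t n) :=
  ip_eq hα hβ ht _ _

theorem normSq_pos {α β t : ℝ} (hα : 0 < α) (hβ : 0 < β) (ht : 0 ≤ t) (n : ℕ) :
    0 < normSq n α β t := by
  rw [normSq_eq hα hβ ht]
  exact originMoment_mul_self_pos hα hβ (Or.inr ⟨ht, zero_le_one⟩) (orthoPoly_monic α β t n).ne_zero

theorem originMoment_orthoPoly_mul_of_lt {α β t : ℝ} (hα : 0 < α) (hβ : 0 < β) (ht : 0 ≤ t)
    {j n : ℕ} (hj : j < n) :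
    originMoment α β t 0 (orthoPoly α β t n * orthoPoly α β t j) = 0 := by
  induction n using Nat.strong_induction_on generalizing j with
  | _ n ih =>
    have hz : ∀ i ∈ Finset.range n, i ≠ j →
        originMoment α β t 0 (orthoPoly α β t i * orthoPoly α β t j) = 0 := by
      intro i hi hij
      rcases lt_or_gt_of_ne hij with h | h
      · rw [mul_comm]; exact ih j hj h
      · exact ih i (Finset.mem_range.1 hi) h
    rw [orthoPoly_eq α β t n, sub_mul, map_sub, Finset.sum_mul, map_sum,
      Finset.sum_eq_single_of_mem j (Finset.mem_range.2 hj)]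
    · rw [mul_assoc, ← smul_eq_C_mul, map_smul, ip_eq hα hβ ht, smul_eq_mul, ← normSq,
        ← normSq_eq hα hβ ht, div_mul_cancel₀ _ (normSq_pos hα hβ ht j).ne', sub_self]
    · intro i hi hij
      rw [mul_assoc, ← smul_eq_C_mul, map_smul, hz i hi hij, smul_zero]

theorem originMoment_orthoPoly_mul_of_degree_lt {α β t : ℝ} (hα : 0 < α) (hβ : 0 < β) (ht : 0 ≤ t)
    {n : ℕ} {g : ℝ[X]} (hg : g.degree < n) : originMoment α β t 0 (orthoPoly α β t n * g) = 0 := by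
  -- Induction on the degree bound: subtracting a multiple of P_d removes the top coefficient of g.
  have : ∀ d ≤ n, ∀ g : ℝ[X], g.degree < d → originMoment α β t 0 (orthoPoly α β t n * g) = 0 := by
    intro d
    induction d with
    | zero =>
      intro _ g hg
      have h0 : g = 0 := by
        ext k
        exact (degree_lt_iff_coeff_zero _ _).1 hg k (Nat.zero_le k)
      simp [h0]
    | succ d ih =>
      intro hd g hg
      have h1 : (g - C (g.coeff d) * orthoPoly α β t d).degree < d := by
        rw [degree_lt_iff_coeff_zero] at hg ⊢
        intro m hm
        rcases eq_or_lt_of_le hm with rfl | h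
        · simp
        · rw [coeff_sub, coeff_C_mul, coeff_orthoPoly_of_lt _ _ _ h, hg m h]; simp
      have h2 := ih (by omega) _ h1
      rw [mul_sub, map_sub, mul_left_comm, ← smul_eq_C_mul, map_smul,
        originMoment_orthoPoly_mul_of_lt hα hβ ht (by omega)] at h2
      simpa using h2
  exact this n le_rfl g hg

theorem originMoment_orthoPoly_mul {α β t : ℝ} (hα : 0 < α) (hβ : 0 < β) (ht : 0 ≤ t)
    {n : ℕ} {g : ℝ[X]} (hg : g.natDegree ≤ n) :
    originMoment α β t 0 (orthoPoly α β t n * g) = g.coeff n * normSq n α β t := by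
  have h1 : (g - C (g.coeff n) * orthoPoly α β t n).degree < n := by
    rw [degree_lt_iff_coeff_zero]
    intro m hm
    rcases eq_or_lt_of_le hm with rfl | h
    · simp
    · rw [coeff_sub, coeff_C_mul, coeff_orthoPoly_of_lt _ _ _ h,
        coeff_eq_zero_of_natDegree_lt (lt_of_le_of_lt hg h)]; simp
  have h2 := originMoment_orthoPoly_mul_of_degree_lt hα hβ ht h1
  rw [mul_sub, map_sub, mul_left_comm, ← smul_eq_C_mul, map_smul, ← normSq_eq hα hβ ht,
    smul_eq_mul] at h2
  linarith

theorem originMoment_orthoPoly_mul_succ {α β t : ℝ} (hα : 0 < α) (hβ : 0 < β) (ht : 0 ≤ t)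
    {n : ℕ} {g : ℝ[X]} (hg : g.natDegree ≤ n + 1) :
    originMoment α β t 0 (orthoPoly α β t n * g) =
      (g.coeff n - g.coeff (n + 1) * (orthoPoly α β t (n + 1)).coeff n) * normSq n α β t := by
  have h1 : (g - C (g.coeff (n + 1)) * orthoPoly α β t (n + 1)).natDegree ≤ n := by
    rw [natDegree_le_iff_coeff_eq_zero]
    intro m hm
    rcases eq_or_lt_of_le (Nat.succ_le_of_lt hm) with rfl | h
    · simp
    · rw [coeff_sub, coeff_C_mul, coeff_orthoPoly_of_lt _ _ _ h,
        coeff_eq_zero_of_natDegree_lt (lt_of_le_of_lt hg h)]; simp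
  have h2 := originMoment_orthoPoly_mul hα hβ ht h1
  rw [mul_sub, map_sub, mul_left_comm, ← smul_eq_C_mul, map_smul,
    mul_comm (orthoPoly α β t n) (orthoPoly α β t (n + 1)),
    originMoment_orthoPoly_mul_of_lt hα hβ ht (Nat.lt_succ_self n)] at h2
  simpa using h2

/-! ### Reduction of singular moments by dividing out the pole. -/

theorem originMoment_one_mul (α β t : ℝ) (p g : ℝ[X]) :
    originMoment α β t 1 (p * g) = g.coeff 0 * originMoment α β t 1 p
      + originMoment α β t 0 (p * divX g) := by
  conv_lhs => rw [← divX_mul_X_add g]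
  rw [mul_add, map_add, mul_comm p (C _), ← smul_eq_C_mul, map_smul, smul_eq_mul,
    show p * (divX g * X) = X * (p * divX g) by ring, originMoment_succ_X_mul]
  ring

theorem originMoment_two_mul (α β t : ℝ) (p g : ℝ[X]) :
    originMoment α β t 2 (p * g) = g.coeff 0 * originMoment α β t 2 p
      + g.coeff 1 * originMoment α β t 1 p + originMoment α β t 0 (p * divX (divX g)) := by
  conv_lhs => rw [← divX_mul_X_add g]
  rw [mul_add, map_add, mul_comm p (C _), ← smul_eq_C_mul, map_smul, smul_eq_mul,
    show p * (divX g * X) = X * (p * divX g) by ring, originMoment_succ_X_mul,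
    originMoment_one_mul, coeff_divX]
  ring

/-- Writing g = g(1) + (x-1)q cancels the pole at 1 in the second term. Applied to p = P_n,
orthogonality then leaves at most the leading coefficient of q. -/
theorem unitMoment_mul {α β t : ℝ} (hα : 0 < α) (hβ : 0 < β) (ht : 0 ≤ t) (p g : ℝ[X]) :
    unitMoment α β t (p * g) = g.eval 1 * unitMoment α β t p
      - originMoment α β t 0 (p * (g /ₘ (X - C 1))) := by
  conv_lhs => rw [← modByMonic_add_div g (X - C 1), modByMonic_X_sub_C_eq_C_eval]
  rw [mul_add, map_add, mul_comm p (C _), ← smul_eq_C_mul, map_smul, smul_eq_mul,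
    show p * ((X - C 1) * (g /ₘ (X - C 1))) = -((1 - X) * (p * (g /ₘ (X - C 1)))) by
      rw [C_1]; ring, map_neg, unitMoment_one_sub_X_mul hα hβ ht]
  ring

section Reduction

variable {α β t : ℝ} {n : ℕ} {g : ℝ[X]}

theorem originMoment_one_orthoPoly_mul (hα : 0 < α) (hβ : 0 < β) (ht : 0 ≤ t)
    (hg : g.natDegree ≤ n + 1) :
    originMoment α β t 1 (orthoPoly α β t n * g) =
      g.coeff 0 * originMoment α β t 1 (orthoPoly α β t n) + g.coeff (n + 1) * normSq n α β t := by
  rw [originMoment_one_mul, originMoment_orthoPoly_mul hα hβ ht, coeff_divX]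
  rw [natDegree_divX_eq_natDegree_tsub_one]; omega

theorem originMoment_two_orthoPoly_mul (hα : 0 < α) (hβ : 0 < β) (ht : 0 ≤ t)
    (hg : g.natDegree ≤ n + 2) :
    originMoment α β t 2 (orthoPoly α β t n * g) =
      g.coeff 0 * originMoment α β t 2 (orthoPoly α β t n)
        + g.coeff 1 * originMoment α β t 1 (orthoPoly α β t n)
        + g.coeff (n + 2) * normSq n α β t := by
  rw [originMoment_two_mul, originMoment_orthoPoly_mul hα hβ ht, coeff_divX, coeff_divX]
  simp only [natDegree_divX_eq_natDegree_tsub_one]; omega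

theorem unitMoment_orthoPoly_mul (hα : 0 < α) (hβ : 0 < β) (ht : 0 ≤ t)
    (hg : g.natDegree ≤ n + 1) :
    unitMoment α β t (orthoPoly α β t n * g) =
      g.eval 1 * unitMoment α β t (orthoPoly α β t n) - g.coeff (n + 1) * normSq n α β t := by
  have hd : (g /ₘ (X - C 1)).natDegree ≤ n := by
    rw [natDegree_divByMonic _ (monic_X_sub_C 1), natDegree_X_sub_C]; omega
  have hc : (g /ₘ (X - C 1)).coeff n = g.coeff (n + 1) := by
    conv_rhs => rw [← modByMonic_add_div g (X - C 1), modByMonic_X_sub_C_eq_C_eval]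
    rw [sub_mul, coeff_add, coeff_sub, coeff_X_mul, coeff_C_mul,
      coeff_eq_zero_of_natDegree_lt (p := g /ₘ (X - C 1)) (n := n + 1) (by omega), coeff_C_succ]
    ring
  rw [unitMoment_mul hα hβ ht, originMoment_orthoPoly_mul hα hβ ht hd, hc]

theorem originMoment_one_orthoPoly_mul_of_le (hα : 0 < α) (hβ : 0 < β) (ht : 0 ≤ t)
    (hg : g.natDegree ≤ n) :
    originMoment α β t 1 (orthoPoly α β t n * g) =
      g.coeff 0 * originMoment α β t 1 (orthoPoly α β t n) := by
  rw [originMoment_one_orthoPoly_mul hα hβ ht (by omega),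
    coeff_eq_zero_of_natDegree_lt (n := n + 1) (by omega), zero_mul, add_zero]

theorem originMoment_two_orthoPoly_mul_of_le (hα : 0 < α) (hβ : 0 < β) (ht : 0 ≤ t)
    (hg : g.natDegree ≤ n + 1) :
    originMoment α β t 2 (orthoPoly α β t n * g) =
      g.coeff 0 * originMoment α β t 2 (orthoPoly α β t n)
        + g.coeff 1 * originMoment α β t 1 (orthoPoly α β t n) := by
  rw [originMoment_two_orthoPoly_mul hα hβ ht (by omega),
    coeff_eq_zero_of_natDegree_lt (n := n + 2) (by omega), zero_mul, add_zero]

theorem unitMoment_orthoPoly_mul_of_le (hα : 0 < α) (hβ : 0 < β) (ht : 0 ≤ t)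
    (hg : g.natDegree ≤ n) :
    unitMoment α β t (orthoPoly α β t n * g) =
      g.eval 1 * unitMoment α β t (orthoPoly α β t n) := by
  rw [unitMoment_orthoPoly_mul hα hβ ht (by omega),
    coeff_eq_zero_of_natDegree_lt (n := n + 1) (by omega), zero_mul, sub_zero]

end Reduction

/-! ### Algebraic identities between the normalized moments at fixed t. -/

/-- The normalized moment `(t / h_n) ∫₀¹ P_n(x)² w(x) / x dx`. -/
def SFun (n : ℕ) (α β t : ℝ) : ℝ :=
  t / normSq n α β t * originMoment α β t 1 (orthoPoly α β t n * orthoPoly α β t n)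

/-- The normalized moment `(β / h_n) ∫₀¹ P_{n+1}(x) P_n(x) w(x) / (1 - x) dx`. -/
def rFun (n : ℕ) (α β t : ℝ) : ℝ :=
  β / normSq n α β t * unitMoment α β t (orthoPoly α β t (n + 1) * orthoPoly α β t n)

section Identities

variable {α β t : ℝ}

theorem RFun_mul_normSq (hα : 0 < α) (hβ : 0 < β) (ht : 0 ≤ t) (n : ℕ) : RFun n α β t * normSq n α β t =
    β * unitMoment α β t (orthoPoly α β t n * orthoPoly α β t n) := by
  have := (normSq_pos hα hβ ht n).ne'
  rw [RFun, unitMoment_eq_integral hα hβ ht]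
  simp_rw [eval_mul, ← sq]
  field_simp

theorem rStar_mul_normSq (hα : 0 < α) (hβ : 0 < β) (ht : 0 ≤ t) (n : ℕ) : rStar (n + 1) α β t * normSq n α β t =
    t * originMoment α β t 1 (orthoPoly α β t (n + 1) * orthoPoly α β t n) := by
  have := (normSq_pos hα hβ ht n).ne'
  rw [rStar, originMoment_eq_integral hα hβ (Or.inr ⟨ht, le_rfl⟩)]
  simp_rw [eval_mul, pow_one, Nat.add_sub_cancel]
  field_simp

theorem SFun_mul_normSq (hα : 0 < α) (hβ : 0 < β) (ht : 0 ≤ t) (n : ℕ) : SFun n α β t * normSq n α β t =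
    t * originMoment α β t 1 (orthoPoly α β t n * orthoPoly α β t n) := by
  have := (normSq_pos hα hβ ht n).ne'
  rw [SFun]; field_simp

theorem rFun_mul_normSq (hα : 0 < α) (hβ : 0 < β) (ht : 0 ≤ t) (n : ℕ) : rFun n α β t * normSq n α β t =
    β * unitMoment α β t (orthoPoly α β t (n + 1) * orthoPoly α β t n) := by
  have := (normSq_pos hα hβ ht n).ne'
  rw [rFun]; field_simp

theorem SFun_pos (hα : 0 < α) (hβ : 0 < β) (ht : 0 < t) (n : ℕ) : 0 < SFun n α β t :=
  mul_pos (div_pos ht (normSq_pos hα hβ ht.le n))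
    (originMoment_mul_self_pos hα hβ (Or.inl ht) (orthoPoly_monic α β t n).ne_zero)

theorem unitMoment_X_mul (hα : 0 < α) (hβ : 0 < β) (ht : 0 ≤ t) (g : ℝ[X]) :
    unitMoment α β t (X * g) = unitMoment α β t g - originMoment α β t 0 g := by
  rw [← unitMoment_one_sub_X_mul hα hβ ht, sub_mul, map_sub]; simp

theorem coeff_X_mul_derivative (p : ℝ[X]) (k : ℕ) :
    (X * derivative p).coeff k = k * p.coeff k := by
  cases k with
  | zero => simp
  | succ k => rw [coeff_X_mul, coeff_derivative]; push_cast; ring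

theorem natDegree_X_mul_derivative_le (p : ℝ[X]) : (X * derivative p).natDegree ≤ p.natDegree := by
  rw [natDegree_le_iff_coeff_eq_zero]
  intro k hk
  rw [coeff_X_mul_derivative, coeff_eq_zero_of_natDegree_lt hk, mul_zero]

theorem coeff_X_mul_X_mul_derivative (p : ℝ[X]) (k : ℕ) :
    (X * (X * derivative p)).coeff k = ((k : ℝ) - 1) * (X * p).coeff k := by
  cases k with
  | zero => simp
  | succ k => rw [coeff_X_mul, coeff_X_mul, coeff_X_mul_derivative]; push_cast; ring

theorem natDegree_X_mul_orthoPoly (α β t : ℝ) (n : ℕ) :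
    (X * orthoPoly α β t n).natDegree = n + 1 := by
  rw [natDegree_X_mul (orthoPoly_monic α β t n).ne_zero, natDegree_orthoPoly]

/-- Integration by parts with the test polynomial x P_n². The Euler operator x d/dx preserves
degree, so orthogonality evaluates the derivative term as (2n+1) h_n. -/
theorem RFun_eq_SFun_add (hα : 0 < α) (hβ : 0 < β) (ht : 0 ≤ t) (n : ℕ) :
    RFun n α β t = SFun n α β t + (2 * n + 1 + α + β) := by
  have hn := (normSq_pos hα hβ ht n).ne'
  have h1 := RFun_mul_normSq hα hβ ht n
  have h2 := SFun_mul_normSq hα hβ ht n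
  have hdeg := natDegree_X_mul_derivative_le (orthoPoly α β t n)
  have hc := coeff_X_mul_derivative (orthoPoly α β t n) n
  have hs := normSq_eq hα hβ ht n
  rw [natDegree_orthoPoly] at hdeg
  rw [coeff_orthoPoly_self] at hc
  have hL := originMoment_orthoPoly_mul hα hβ ht hdeg
  generalize orthoPoly α β t n = P at *
  have key := moment_derivative hα hβ ht (X * (P * P))
  have hd : derivative (X * (P * P)) = P * P + (2 : ℝ) • (P * (X * derivative P)) := by
    rw [smul_eq_C_mul]
    simp only [derivative_mul, derivative_X, map_ofNat]; ring
  rw [originMoment_succ_X_mul, originMoment_succ_X_mul, unitMoment_X_mul hα hβ ht,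
    hd, map_add, map_smul, hL, hc, ← hs, smul_eq_mul] at key
  apply mul_right_cancel₀ hn
  linear_combination h1 - h2 - key

theorem originMoment_orthoPoly_mul_derivative (hα : 0 < α) (hβ : 0 < β) (ht : 0 ≤ t) {n : ℕ}
    {g : ℝ[X]} (hg : g.natDegree ≤ n) :
    originMoment α β t 0 (orthoPoly α β t n * derivative g) = 0 := by
  refine originMoment_orthoPoly_mul_of_degree_lt hα hβ ht ?_
  rcases eq_or_ne g 0 with rfl | h
  · simp
  · exact lt_of_lt_of_le (degree_derivative_lt h) (degree_le_of_natDegree_le hg)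

/-- Test polynomial P_n², whose derivative term vanishes by orthogonality. This trades the pole at 1
for poles at 0, where the moments defining S_n and r_n^* live. -/
theorem RFun_mul_normSq_eq_originMoment (hα : 0 < α) (hβ : 0 < β) (ht : 0 ≤ t) (n : ℕ) :
    RFun n α β t * normSq n α β t =
      α * originMoment α β t 1 (orthoPoly α β t n * orthoPoly α β t n)
        + t * originMoment α β t 2 (orthoPoly α β t n * orthoPoly α β t n) := by
  rw [RFun_mul_normSq hα hβ ht]
  have hL := originMoment_orthoPoly_mul_derivative hα hβ ht (natDegree_orthoPoly α β t n).le
  have key := moment_derivative hα hβ ht (orthoPoly α β t n * orthoPoly α β t n)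
  rw [derivative_mul, map_add, mul_comm (derivative _), hL] at key
  linear_combination -key

theorem rFun_mul_normSq_eq_originMoment (hα : 0 < α) (hβ : 0 < β) (ht : 0 ≤ t) (n : ℕ) :
    (rFun n α β t - (n + 1)) * normSq n α β t =
      α * originMoment α β t 1 (orthoPoly α β t (n + 1) * orthoPoly α β t n)
        + t * originMoment α β t 2 (orthoPoly α β t (n + 1) * orthoPoly α β t n) := by
  rw [sub_mul, rFun_mul_normSq hα hβ ht]
  have hL := originMoment_orthoPoly_mul_derivative hα hβ ht
    ((natDegree_orthoPoly α β t n).le.trans n.le_succ)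
  have hL' : originMoment α β t 0 (orthoPoly α β t n * derivative (orthoPoly α β t (n + 1))) =
      (n + 1) * normSq n α β t := by
    rw [originMoment_orthoPoly_mul hα hβ ht, coeff_derivative, coeff_orthoPoly_self, one_mul]
    refine (natDegree_derivative_le _).trans ?_
    simp
  have key := moment_derivative hα hβ ht (orthoPoly α β t (n + 1) * orthoPoly α β t n)
  rw [derivative_mul, map_add, mul_comm (derivative _), hL', hL] at key
  linear_combination -key

/-- Test polynomial x P_{n+1} P_n. With c the subleading coefficient of P_{n+1}, the derivative term
contributes (n - (n+1)) c h_n. -/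
theorem rStar_sub_rFun (hα : 0 < α) (hβ : 0 < β) (ht : 0 ≤ t) (n : ℕ) :
    rStar (n + 1) α β t - rFun n α β t = (orthoPoly α β t (n + 1)).coeff n := by
  have hn := (normSq_pos hα hβ ht n).ne'
  have h1 := rStar_mul_normSq hα hβ ht n
  have h2 := rFun_mul_normSq hα hβ ht n
  have h0 := originMoment_orthoPoly_mul_of_lt hα hβ ht n.lt_succ_self
  have hdeg := natDegree_X_mul_derivative_le (orthoPoly α β t n)
  have hdeg' := natDegree_X_mul_derivative_le (orthoPoly α β t (n + 1))
  have hc := coeff_X_mul_derivative (orthoPoly α β t n) (n + 1)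
  have hc' := coeff_X_mul_derivative (orthoPoly α β t (n + 1))
  rw [natDegree_orthoPoly] at hdeg hdeg'
  rw [coeff_orthoPoly_of_lt _ _ _ n.lt_succ_self] at hc
  have hL := originMoment_orthoPoly_mul hα hβ ht (hdeg.trans n.le_succ)
  have hL' := originMoment_orthoPoly_mul_succ hα hβ ht hdeg'
  rw [hc', hc', coeff_orthoPoly_self] at hL'
  rw [hc] at hL
  generalize orthoPoly α β t n = Q at *
  generalize orthoPoly α β t (n + 1) = P at *
  have key := moment_derivative hα hβ ht (X * (P * Q))
  have hd : derivative (X * (P * Q)) =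
      P * Q + Q * (X * derivative P) + P * (X * derivative Q) := by
    simp only [derivative_mul, derivative_X]; ring
  rw [originMoment_succ_X_mul, originMoment_succ_X_mul, unitMoment_X_mul hα hβ ht,
    hd, map_add, map_add, hL, hL', h0] at key
  apply mul_right_cancel₀ hn
  push_cast at key
  linear_combination h1 - h2 + key

/-- Test polynomial x² P_n². The coefficient of x^n in x P_n is the subleading coefficient of P_n,
and in this form it is correctly 0 for n = 0. -/
theorem RFun_eq_coeff (hα : 0 < α) (hβ : 0 < β) (ht : 0 ≤ t) (n : ℕ) :
    RFun n α β t = (2 * n + 2 + α + β) * ((X * orthoPoly α β t n).coeff n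
        - (orthoPoly α β t (n + 1)).coeff n) - 2 * (X * orthoPoly α β t n).coeff n + β + t := by
  have hn := (normSq_pos hα hβ ht n).ne'
  have h1 := RFun_mul_normSq hα hβ ht n
  have hdeg := (natDegree_X_mul_orthoPoly α β t n).le
  have hdeg' : (X * (X * derivative (orthoPoly α β t n))).natDegree ≤ n + 1 := by
    refine natDegree_mul_le.trans ?_
    have := natDegree_X_mul_derivative_le (orthoPoly α β t n)
    rw [natDegree_orthoPoly] at this
    rw [natDegree_X]; omega
  have hL := originMoment_orthoPoly_mul_succ hα hβ ht hdeg
  have hL' := originMoment_orthoPoly_mul_succ hα hβ ht hdeg'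
  rw [coeff_X_mul_X_mul_derivative, coeff_X_mul_X_mul_derivative] at hL'
  rw [coeff_X_mul _ n, coeff_orthoPoly_self] at hL hL'
  rw [mul_left_comm] at hL
  have hs := normSq_eq hα hβ ht n
  generalize orthoPoly α β t n = P at *
  generalize (orthoPoly α β t (n + 1)).coeff n = b at *
  have key := moment_derivative hα hβ ht (X * (X * (P * P)))
  have hd : derivative (X * (X * (P * P))) =
      (2 : ℝ) • (P * (X * P) + P * (X * (X * derivative P))) := by
    rw [smul_eq_C_mul]
    simp only [derivative_mul, derivative_X, map_ofNat]; ring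
  rw [originMoment_succ_X_mul, originMoment_succ_X_mul, originMoment_succ_X_mul,
    unitMoment_X_mul hα hβ ht, unitMoment_X_mul hα hβ ht,
    hd, map_smul, map_add, hL', mul_left_comm, hL, ← hs, smul_eq_mul] at key
  apply mul_right_cancel₀ hn
  push_cast at key
  linear_combination h1 - key

/-- The integral of P_{n+1} P_n w/x can be reduced by orthogonality of either factor; the second way
produces an extra h_n. Multiplying the two evaluations gives the product of the two diagonal
moments. -/
theorem rStar_mul_rStar_sub (hα : 0 < α) (hβ : 0 < β) (ht : 0 ≤ t) (n : ℕ) :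
    rStar (n + 1) α β t * (rStar (n + 1) α β t - t) * normSq n α β t =
      normSq (n + 1) α β t * (SFun (n + 1) α β t * SFun n α β t) := by
  have hn := (normSq_pos hα hβ ht n).ne'
  have hP := (natDegree_orthoPoly α β t (n + 1)).le
  have hQ := (natDegree_orthoPoly α β t n).le
  have h1 := rStar_mul_normSq hα hβ ht n
  have h2 := h1
  have h3 := SFun_mul_normSq hα hβ ht n
  have h4 := SFun_mul_normSq hα hβ ht (n + 1)
  rw [originMoment_one_orthoPoly_mul_of_le hα hβ ht (hQ.trans (by omega))] at h1
  rw [mul_comm (orthoPoly α β t (n + 1)), originMoment_one_orthoPoly_mul hα hβ ht hP,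
    coeff_orthoPoly_self] at h2
  rw [originMoment_one_orthoPoly_mul_of_le hα hβ ht (hQ.trans (by omega))] at h3
  rw [originMoment_one_orthoPoly_mul_of_le hα hβ ht (hP.trans (by omega))] at h4
  apply mul_right_cancel₀ hn
  rw [show normSq (n + 1) α β t * (SFun (n + 1) α β t * SFun n α β t) * normSq n α β t =
    SFun (n + 1) α β t * normSq (n + 1) α β t * (SFun n α β t * normSq n α β t) by ring, h3, h4,
    show rStar (n + 1) α β t * (rStar (n + 1) α β t - t) * normSq n α β t * normSq n α β t =
    rStar (n + 1) α β t * normSq n α β t * (rStar (n + 1) α β t * normSq n α β t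
      - t * normSq n α β t) by ring]
  -- The two occurrences of `rStar` receive different evaluations: the first reduces by P_{n+1}, the
  -- second by P_n.
  nth_rewrite 1 [h1]
  rw [h2]
  ring

theorem rFun_mul_rFun_add (hα : 0 < α) (hβ : 0 < β) (ht : 0 ≤ t) (n : ℕ) :
    rFun n α β t * (rFun n α β t + β) * normSq n α β t =
      normSq (n + 1) α β t * (RFun (n + 1) α β t * RFun n α β t) := by
  have hn := (normSq_pos hα hβ ht n).ne'
  have hP := (natDegree_orthoPoly α β t (n + 1)).le
  have hQ := (natDegree_orthoPoly α β t n).le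
  have h1 := rFun_mul_normSq hα hβ ht n
  have h2 := h1
  have h3 := RFun_mul_normSq hα hβ ht n
  have h4 := RFun_mul_normSq hα hβ ht (n + 1)
  rw [unitMoment_orthoPoly_mul_of_le hα hβ ht (hQ.trans (by omega))] at h1
  rw [mul_comm (orthoPoly α β t (n + 1)), unitMoment_orthoPoly_mul hα hβ ht hP,
    coeff_orthoPoly_self] at h2
  rw [unitMoment_orthoPoly_mul_of_le hα hβ ht (hQ.trans (by omega))] at h3
  rw [unitMoment_orthoPoly_mul_of_le hα hβ ht (hP.trans (by omega))] at h4
  apply mul_right_cancel₀ hn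
  rw [show normSq (n + 1) α β t * (RFun (n + 1) α β t * RFun n α β t) * normSq n α β t =
    RFun (n + 1) α β t * normSq (n + 1) α β t * (RFun n α β t * normSq n α β t) by ring, h3, h4,
    show rFun n α β t * (rFun n α β t + β) * normSq n α β t * normSq n α β t =
    rFun n α β t * normSq n α β t * (rFun n α β t * normSq n α β t
      + β * normSq n α β t) by ring]
  nth_rewrite 1 [h1]
  rw [h2]
  ring

/-- The mixed companion of the two preceding identities. R and r are first rewritten through moments
at 0, so that every quantity is expressed by the low coefficients of P_n, P_{n+1} and their 1/x and
1/x² moments. -/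
theorem two_mul_rStar_sub_mul (hα : 0 < α) (hβ : 0 < β) (ht : 0 ≤ t) (n : ℕ) :
    ((2 * rStar (n + 1) α β t - t) * (rFun n α β t - (n + 1)) - α * rStar (n + 1) α β t)
        * normSq n α β t =
      normSq (n + 1) α β t * (RFun (n + 1) α β t * SFun n α β t
        + SFun (n + 1) α β t * RFun n α β t) := by
  have hn := (normSq_pos hα hβ ht n).ne'
  have hP := (natDegree_orthoPoly α β t (n + 1)).le
  have hQ := (natDegree_orthoPoly α β t n).le
  have h1 := rStar_mul_normSq hα hβ ht n
  have h2 := h1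
  have h3 := SFun_mul_normSq hα hβ ht n
  have h4 := SFun_mul_normSq hα hβ ht (n + 1)
  have h5 := rFun_mul_normSq_eq_originMoment hα hβ ht n
  have h6 := h5
  have h7 := RFun_mul_normSq_eq_originMoment hα hβ ht n
  have h8 := RFun_mul_normSq_eq_originMoment hα hβ ht (n + 1)
  rw [originMoment_one_orthoPoly_mul_of_le hα hβ ht (hQ.trans (by omega))] at h1
  rw [mul_comm (orthoPoly α β t (n + 1)), originMoment_one_orthoPoly_mul hα hβ ht hP,
    coeff_orthoPoly_self] at h2
  rw [originMoment_one_orthoPoly_mul_of_le hα hβ ht (hQ.trans (by omega))] at h3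
  rw [originMoment_one_orthoPoly_mul_of_le hα hβ ht (hP.trans (by omega))] at h4
  rw [originMoment_one_orthoPoly_mul_of_le hα hβ ht (hQ.trans (by omega)),
    originMoment_two_orthoPoly_mul_of_le hα hβ ht (hQ.trans (by omega))] at h5
  rw [mul_comm (orthoPoly α β t (n + 1)), originMoment_one_orthoPoly_mul hα hβ ht hP,
    originMoment_two_orthoPoly_mul_of_le hα hβ ht (hP.trans (by omega)),
    coeff_orthoPoly_self] at h6
  rw [originMoment_one_orthoPoly_mul_of_le hα hβ ht (hQ.trans (by omega)),
    originMoment_two_orthoPoly_mul_of_le hα hβ ht (hQ.trans (by omega))] at h7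
  rw [originMoment_one_orthoPoly_mul_of_le hα hβ ht (hP.trans (by omega)),
    originMoment_two_orthoPoly_mul_of_le hα hβ ht (hP.trans (by omega))] at h8
  apply mul_right_cancel₀ hn
  rw [show normSq (n + 1) α β t * (RFun (n + 1) α β t * SFun n α β t
        + SFun (n + 1) α β t * RFun n α β t) * normSq n α β t =
      RFun (n + 1) α β t * normSq (n + 1) α β t * (SFun n α β t * normSq n α β t)
      + SFun (n + 1) α β t * normSq (n + 1) α β t * (RFun n α β t * normSq n α β t) by ring,
    h3, h4, h7, h8,
    show ((2 * rStar (n + 1) α β t - t) * (rFun n α β t - (n + 1)) - α * rStar (n + 1) α β t)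
        * normSq n α β t * normSq n α β t =
      rStar (n + 1) α β t * normSq n α β t * ((rFun n α β t - (n + 1)) * normSq n α β t)
      + (rStar (n + 1) α β t * normSq n α β t - t * normSq n α β t)
        * ((rFun n α β t - (n + 1)) * normSq n α β t)
      - α * (rStar (n + 1) α β t * normSq n α β t) * normSq n α β t by ring]
  nth_rewrite 1 [h6]
  rw [h5]
  nth_rewrite 2 [h2]
  rw [h1]
  ring

/-- The partial sums of the normalized moments, in terms of the subleading coefficient of `P_n`. -/
theorem sum_SFun (hα : 0 < α) (hβ : 0 < β) (ht : 0 ≤ t) (n : ℕ) :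
    ∑ j ∈ Finset.range n, SFun j α β t =
      -((2 * n + α + β) * (X * orthoPoly α β t n).coeff n + n * (n + α - t)) := by
  induction n with
  | zero => simp
  | succ n ih =>
    rw [Finset.sum_range_succ, ih, coeff_X_mul]
    -- Together these two identities express S_n by consecutive subleading coefficients with weights
    -- 2n+α+β and 2n+2+α+β, so the sum telescopes.
    have h1 := RFun_eq_SFun_add hα hβ ht n
    have h2 := RFun_eq_coeff hα hβ ht n
    push_cast
    linear_combination h2 - h1

end Identities

/-! ### Differentiable and continuous families of polynomials. -/

/-- The family `P` of polynomials has bounded degree, and its coefficients are differentiable at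
`t` with derivatives the coefficients of `P'`. -/
def HasPolyDerivAt (P : ℝ → ℝ[X]) (P' : ℝ[X]) (t : ℝ) : Prop :=
  (∃ d, ∀ s, (P s).natDegree ≤ d) ∧ ∀ k, HasDerivAt (fun s => (P s).coeff k) (P'.coeff k) t

/-- The family `P` of polynomials has bounded degree, and its coefficients are continuous on the
set `A`. -/
def PolyContinuousOn (P : ℝ → ℝ[X]) (A : Set ℝ) : Prop :=
  (∃ d, ∀ s, (P s).natDegree ≤ d) ∧ ∀ k, ContinuousOn (fun s => (P s).coeff k) A

namespace HasPolyDerivAt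

variable {P R : ℝ → ℝ[X]} {P' R' : ℝ[X]} {t : ℝ}

theorem const (g : ℝ[X]) (t : ℝ) : HasPolyDerivAt (fun _ => g) 0 t :=
  ⟨⟨_, fun _ => le_rfl⟩, fun k => by simpa using hasDerivAt_const t (g.coeff k)⟩

theorem C {f : ℝ → ℝ} {f' : ℝ} (h : HasDerivAt f f' t) :
    HasPolyDerivAt (fun s => Polynomial.C (f s)) (Polynomial.C f') t := by
  refine ⟨⟨0, fun s => by simp⟩, fun k => ?_⟩
  simp only [coeff_C]
  split_ifs
  · exact h
  · exact hasDerivAt_const t 0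

theorem sub (hP : HasPolyDerivAt P P' t) (hR : HasPolyDerivAt R R' t) :
    HasPolyDerivAt (fun s => P s - R s) (P' - R') t := by
  obtain ⟨⟨d, hd⟩, hP⟩ := hP
  obtain ⟨⟨e, he⟩, hR⟩ := hR
  refine ⟨⟨max d e, fun s => (natDegree_sub_le _ _).trans (max_le_max (hd s) (he s))⟩,
    fun k => ?_⟩
  simpa only [coeff_sub] using (hP k).fun_sub (hR k)

theorem mul (hP : HasPolyDerivAt P P' t) (hR : HasPolyDerivAt R R' t) :
    HasPolyDerivAt (fun s => P s * R s) (P' * R t + P t * R') t := by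
  obtain ⟨⟨d, hd⟩, hP⟩ := hP
  obtain ⟨⟨e, he⟩, hR⟩ := hR
  refine ⟨⟨d + e, fun s => natDegree_mul_le.trans (add_le_add (hd s) (he s))⟩, fun k => ?_⟩
  simp only [coeff_add, coeff_mul, ← Finset.sum_add_distrib]
  exact HasDerivAt.fun_sum fun x _ => (hP x.1).mul (hR x.2)

theorem sum {ι : Type*} {A : Finset ι} {F : ι → ℝ → ℝ[X]} {F' : ι → ℝ[X]}
    (h : ∀ i ∈ A, HasPolyDerivAt (F i) (F' i) t) :
    HasPolyDerivAt (fun s => ∑ i ∈ A, F i s) (∑ i ∈ A, F' i) t := by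
  classical
  choose! d hd using fun i hi => (h i hi).1
  refine ⟨⟨A.sup d, fun s => natDegree_sum_le_of_forall_le _ _ fun i hi =>
    (hd i hi s).trans (Finset.le_sup hi)⟩, fun k => ?_⟩
  simp only [finsetSum_coeff]
  exact HasDerivAt.fun_sum fun i hi => (h i hi).2 k

theorem originMoment {α β : ℝ} (hα : 0 < α) (hβ : 0 < β) (ht : 0 < t)
    (hP : HasPolyDerivAt P P' t) (k : ℕ) :
    HasDerivAt (fun s => originMoment α β s k (P s))
      (originMoment α β t k P' - originMoment α β t (k + 1) (P t)) t := by
  obtain ⟨⟨d, hd⟩, hP⟩ := hP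
  -- Coefficients beyond the common degree bound vanish identically in s, hence so do their
  -- derivatives.
  have hd' : P'.natDegree ≤ d := by
    rw [natDegree_le_iff_coeff_eq_zero]
    intro i hi
    have : (fun s => (P s).coeff i) = fun _ => 0 :=
      funext fun s => coeff_eq_zero_of_natDegree_lt ((hd s).trans_lt hi)
    have h := hP i
    rw [this] at h
    exact h.unique (hasDerivAt_const t 0)
  have e : (fun s => PollaczekJacobi.originMoment α β s k (P s)) = fun s =>
      ∑ i ∈ Finset.range (d + 1), (P s).coeff i * PollaczekJacobi.originMoment α β s k (X ^ i) :=
    funext fun s => linearMap_eq_sum _ _ (hd s)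
  rw [e, linearMap_eq_sum _ _ hd', linearMap_eq_sum _ _ (hd t), ← Finset.sum_sub_distrib]
  refine HasDerivAt.fun_sum fun i _ => ?_
  refine ((hP i).mul (hasDerivAt_originMoment hα hβ ht k (X ^ i))).congr_deriv ?_
  ring

end HasPolyDerivAt

namespace PolyContinuousOn

variable {P R : ℝ → ℝ[X]} {A : Set ℝ}

theorem const (g : ℝ[X]) (A : Set ℝ) : PolyContinuousOn (fun _ => g) A :=
  ⟨⟨_, fun _ => le_rfl⟩, fun _ => continuousOn_const⟩

theorem C {f : ℝ → ℝ} (h : ContinuousOn f A) :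
    PolyContinuousOn (fun s => Polynomial.C (f s)) A := by
  refine ⟨⟨0, fun s => by simp⟩, fun k => ?_⟩
  simp only [coeff_C]
  split_ifs
  · exact h
  · exact continuousOn_const

theorem sub (hP : PolyContinuousOn P A) (hR : PolyContinuousOn R A) :
    PolyContinuousOn (fun s => P s - R s) A := by
  obtain ⟨⟨d, hd⟩, hP⟩ := hP
  obtain ⟨⟨e, he⟩, hR⟩ := hR
  refine ⟨⟨max d e, fun s => (natDegree_sub_le _ _).trans (max_le_max (hd s) (he s))⟩,
    fun k => ?_⟩
  simpa only [coeff_sub] using (hP k).fun_sub (hR k)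

theorem mul (hP : PolyContinuousOn P A) (hR : PolyContinuousOn R A) :
    PolyContinuousOn (fun s => P s * R s) A := by
  obtain ⟨⟨d, hd⟩, hP⟩ := hP
  obtain ⟨⟨e, he⟩, hR⟩ := hR
  refine ⟨⟨d + e, fun s => natDegree_mul_le.trans (add_le_add (hd s) (he s))⟩, fun k => ?_⟩
  simp only [coeff_mul]
  exact continuousOn_finsetSum _ fun x _ => (hP x.1).mul (hR x.2)

theorem sum {ι : Type*} {B : Finset ι} {F : ι → ℝ → ℝ[X]}
    (h : ∀ i ∈ B, PolyContinuousOn (F i) A) :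
    PolyContinuousOn (fun s => ∑ i ∈ B, F i s) A := by
  classical
  choose! d hd using fun i hi => (h i hi).1
  refine ⟨⟨B.sup d, fun s => natDegree_sum_le_of_forall_le _ _ fun i hi =>
    (hd i hi s).trans (Finset.le_sup hi)⟩, fun k => ?_⟩
  simp only [finsetSum_coeff]
  exact continuousOn_finsetSum _ fun i hi => (h i hi).2 k

theorem originMoment {α β : ℝ} (hα : 0 < α) (hβ : 0 < β) {k : ℕ} (hk : k ≤ 1)
    (hP : PolyContinuousOn P (Ici 0)) :
    ContinuousOn (fun s => originMoment α β s k (P s)) (Ici 0) := by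
  obtain ⟨⟨d, hd⟩, hP⟩ := hP
  have e : (fun s => PollaczekJacobi.originMoment α β s k (P s)) = fun s =>
      ∑ i ∈ Finset.range (d + 1), (P s).coeff i * PollaczekJacobi.originMoment α β s k (X ^ i) :=
    funext fun s => linearMap_eq_sum _ _ (hd s)
  rw [e]
  exact continuousOn_finsetSum _ fun i _ => (hP i).mul (continuousOn_originMoment hα hβ hk (X ^ i))

end PolyContinuousOn

theorem exists_hasPolyDerivAt_orthoPoly {α β t : ℝ} (hα : 0 < α) (hβ : 0 < β) (ht : 0 < t)
    (n : ℕ) : ∃ Q, HasPolyDerivAt (fun s => orthoPoly α β s n) Q t := by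
  induction n using Nat.strong_induction_on with
  | _ n ih =>
    choose! Q hQ using ih
    have hip : ∀ {P R : ℝ → ℝ[X]} {P' R' : ℝ[X]}, HasPolyDerivAt P P' t → HasPolyDerivAt R R' t →
        DifferentiableAt ℝ (fun s => ip α β s (P s) (R s)) t := by
      intro P R P' R' hP hR
      refine (((hP.mul hR).originMoment hα hβ ht 0).congr_of_eventuallyEq ?_).differentiableAt
      filter_upwards [Ioi_mem_nhds ht] with s hs using ip_eq hα hβ (le_of_lt hs) _ _
    have hd : ∀ j ∈ Finset.range n, HasPolyDerivAt (fun s =>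
        C (ip α β s (X ^ n) (orthoPoly α β s j) / ip α β s (orthoPoly α β s j) (orthoPoly α β s j))
          * orthoPoly α β s j) _ t := fun j hj =>
      (HasPolyDerivAt.C ((hip (HasPolyDerivAt.const (X ^ n) t) (hQ j (Finset.mem_range.1 hj))).div
        (hip (hQ j (Finset.mem_range.1 hj)) (hQ j (Finset.mem_range.1 hj)))
        (normSq_pos hα hβ ht.le j).ne').hasDerivAt).mul (hQ j (Finset.mem_range.1 hj))
    have := (HasPolyDerivAt.const (X ^ n) t).sub (HasPolyDerivAt.sum hd)
    simp_rw [← orthoPoly_eq] at this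
    exact ⟨_, this⟩

theorem polyContinuousOn_orthoPoly {α β : ℝ} (hα : 0 < α) (hβ : 0 < β) (n : ℕ) :
    PolyContinuousOn (fun s => orthoPoly α β s n) (Ici 0) := by
  induction n using Nat.strong_induction_on with
  | _ n ih =>
    have hip : ∀ {P R : ℝ → ℝ[X]}, PolyContinuousOn P (Ici 0) → PolyContinuousOn R (Ici 0) →
        ContinuousOn (fun s => ip α β s (P s) (R s)) (Ici 0) := fun hP hR =>
      ((hP.mul hR).originMoment hα hβ zero_le_one).congr fun s hs => ip_eq hα hβ hs _ _
    have hd : ∀ j ∈ Finset.range n, PolyContinuousOn (fun s =>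
        C (ip α β s (X ^ n) (orthoPoly α β s j) / ip α β s (orthoPoly α β s j) (orthoPoly α β s j))
          * orthoPoly α β s j) (Ici 0) := fun j hj => by
      have hj := ih j (Finset.mem_range.1 hj)
      exact (PolyContinuousOn.C ((hip (PolyContinuousOn.const (X ^ n) _) hj).div (hip hj hj)
        fun s hs => (normSq_pos hα hβ hs j).ne')).mul hj
    have := (PolyContinuousOn.const (X ^ n) (Ici 0)).sub (PolyContinuousOn.sum hd)
    simp_rw [← orthoPoly_eq] at this
    exact this

theorem continuousOn_normSq {α β : ℝ} (hα : 0 < α) (hβ : 0 < β) (n : ℕ) :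
    ContinuousOn (normSq n α β) (Ici 0) :=
  (((polyContinuousOn_orthoPoly hα hβ n).mul (polyContinuousOn_orthoPoly hα hβ n)).originMoment
    hα hβ zero_le_one).congr fun _ hs => normSq_eq hα hβ hs n

theorem continuousOn_SFun {α β : ℝ} (hα : 0 < α) (hβ : 0 < β) (n : ℕ) :
    ContinuousOn (SFun n α β) (Ici 0) :=
  (continuousOn_id.div (continuousOn_normSq hα hβ n) fun _ hs => (normSq_pos hα hβ hs n).ne').mul
    (((polyContinuousOn_orthoPoly hα hβ n).mul (polyContinuousOn_orthoPoly hα hβ n)).originMoment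
      hα hβ le_rfl)

theorem tendsto_SFun {α β : ℝ} (hα : 0 < α) (hβ : 0 < β) (n : ℕ) :
    Tendsto (SFun n α β) (𝓝[>] 0) (𝓝 0) := by
  have h := (continuousOn_SFun hα hβ n) 0 self_mem_Ici
  have h0 : SFun n α β 0 = 0 := by simp [SFun]
  rw [ContinuousWithinAt, h0] at h
  exact h.mono_left (nhdsWithin_mono _ Ioi_subset_Ici_self)

/-! ### Evolution in t. -/

theorem natDegree_le_of_degree_lt_succ {p : ℝ[X]} {n : ℕ}
    (h : p.degree < ((n + 1 : ℕ) : WithBot ℕ)) : p.natDegree ≤ n :=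
  natDegree_le_iff_coeff_eq_zero.2 fun k hk => (degree_lt_iff_coeff_zero _ _).1 h k hk

section Evolution

variable {α β t : ℝ} {n : ℕ} {Q : ℝ[X]}

theorem degree_orthoPoly_deriv_lt (hQ : HasPolyDerivAt (fun s => orthoPoly α β s n) Q t) :
    Q.degree < n := by
  rw [degree_lt_iff_coeff_zero]
  intro k hk
  have h := hQ.2 k
  rcases eq_or_lt_of_le hk with rfl | hk
  · simp only [coeff_orthoPoly_self] at h
    exact h.unique (hasDerivAt_const t 1)
  · simp only [coeff_orthoPoly_of_lt _ _ _ hk] at h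
    exact h.unique (hasDerivAt_const t 0)

/-- With g fixed, P_n(·; s) stays orthogonal to g for every s > 0; differentiating this in s
balances ∂P_n/∂t against ∂w/∂t = -w/x. -/
theorem originMoment_orthoPoly_deriv_mul (hα : 0 < α) (hβ : 0 < β) (ht : 0 < t)
    (hQ : HasPolyDerivAt (fun s => orthoPoly α β s n) Q t) {g : ℝ[X]} (hg : g.degree < n) :
    originMoment α β t 0 (Q * g) = originMoment α β t 1 (orthoPoly α β t n * g) := by
  have h := (hQ.mul (HasPolyDerivAt.const g t)).originMoment hα hβ ht 0
  have h0 : HasDerivAt (fun s => originMoment α β s 0 (orthoPoly α β s n * g)) 0 t := by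
    refine (hasDerivAt_const t (0 : ℝ)).congr_of_eventuallyEq ?_
    filter_upwards [Ioi_mem_nhds ht] with s hs
      using originMoment_orthoPoly_mul_of_degree_lt hα hβ (le_of_lt hs) hg
  have := h.unique h0
  rw [mul_zero, add_zero] at this
  linarith

theorem hasDerivAt_normSq (hα : 0 < α) (hβ : 0 < β) (ht : 0 < t) (n : ℕ) :
    HasDerivAt (normSq n α β) (-(SFun n α β t * normSq n α β t / t)) t := by
  obtain ⟨Q, hQ⟩ := exists_hasPolyDerivAt_orthoPoly hα hβ ht n
  have h := (hQ.mul hQ).originMoment hα hβ ht 0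
  rw [mul_comm Q, map_add,
    originMoment_orthoPoly_mul_of_degree_lt hα hβ ht.le (degree_orthoPoly_deriv_lt hQ)] at h
  rw [SFun_mul_normSq hα hβ ht.le, mul_div_cancel_left₀ _ ht.ne']
  refine (h.congr_of_eventuallyEq ?_).congr_deriv (by simp)
  filter_upwards [Ioi_mem_nhds ht] with s hs using normSq_eq hα hβ (le_of_lt hs) n

theorem mul_coeff_orthoPoly_deriv (hα : 0 < α) (hβ : 0 < β) (ht : 0 < t)
    (hQ : HasPolyDerivAt (fun s => orthoPoly α β s (n + 1)) Q t) :
    t * Q.coeff n = rStar (n + 1) α β t := by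
  have hn := (normSq_pos hα hβ ht.le n).ne'
  have hd := degree_orthoPoly_deriv_lt hQ
  have h := originMoment_orthoPoly_deriv_mul hα hβ ht hQ (g := orthoPoly α β t n)
    ((degree_le_of_natDegree_le (natDegree_orthoPoly α β t n).le).trans_lt
      (by exact_mod_cast n.lt_succ_self))
  rw [mul_comm Q, originMoment_orthoPoly_mul hα hβ ht.le (natDegree_le_of_degree_lt_succ hd)] at h
  apply mul_right_cancel₀ hn
  rw [rStar_mul_normSq hα hβ ht.le, mul_assoc, h]

/-- The evolution of `P_{n+1}` in `t`: `t x ∂P_{n+1}/∂t` is a combination of `P_{n+1}` and `P_n`. -/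
theorem X_mul_orthoPoly_deriv (hα : 0 < α) (hβ : 0 < β) (ht : 0 < t)
    (hQ : HasPolyDerivAt (fun s => orthoPoly α β s (n + 1)) Q t) :
    C t * (X * Q) = C (rStar (n + 1) α β t) * orthoPoly α β t (n + 1)
      - C (normSq (n + 1) α β t / normSq n α β t * SFun (n + 1) α β t) * orthoPoly α β t n := by
  have hn := (normSq_pos hα hβ ht.le n).ne'
  have hc := mul_coeff_orthoPoly_deriv hα hβ ht hQ
  have hd := degree_orthoPoly_deriv_lt hQ
  have hS := SFun_mul_normSq hα hβ ht.le (n + 1)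
  have hL : ∀ g : ℝ[X], g.degree < ((n + 1 : ℕ) : WithBot ℕ) →
      originMoment α β t 0 (Q * g) = originMoment α β t 1 (orthoPoly α β t (n + 1) * g) :=
    fun g hg => originMoment_orthoPoly_deriv_mul hα hβ ht hQ hg
  have hLQ := originMoment_orthoPoly_mul_of_degree_lt hα hβ ht.le hd
  set b := normSq (n + 1) α β t / normSq n α β t * SFun (n + 1) α β t with hb
  set P := orthoPoly α β t (n + 1) with hP
  set ρ := rStar (n + 1) α β t
  -- D is the defect of the claimed formula. The choice of ρ cancels its top coefficient, and D is
  -- then shown to be orthogonal to itself.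
  set D := C t * (X * Q) - C ρ * P + C b * orthoPoly α β t n with hD
  have hdD : D.degree < ((n + 1 : ℕ) : WithBot ℕ) := by
    rw [degree_lt_iff_coeff_zero]
    intro k hk
    obtain ⟨j, rfl⟩ : ∃ j, k = j + 1 := ⟨k - 1, by omega⟩
    rw [hD, coeff_add, coeff_sub, coeff_C_mul, coeff_C_mul, coeff_C_mul, coeff_X_mul,
      coeff_orthoPoly_of_lt α β t (show n < j + 1 by omega)]
    rcases eq_or_lt_of_le hk with h | h
    · obtain rfl : n = j := by omega
      rw [hc, hP, coeff_orthoPoly_self]; ring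
    · rw [(degree_lt_iff_coeff_zero _ _).1 hd j (by omega), hP,
        coeff_orthoPoly_of_lt α β t (show n + 1 < j + 1 by omega)]; ring
  -- x D may have degree n+1, one too many for `hL`; subtracting a multiple of P makes it
  -- admissible.
  have hdX : (X * D - C (D.coeff n) * P).degree < ((n + 1 : ℕ) : WithBot ℕ) := by
    rw [degree_lt_iff_coeff_zero]
    intro k hk
    obtain ⟨j, rfl⟩ : ∃ j, k = j + 1 := ⟨k - 1, by omega⟩
    rw [coeff_sub, coeff_C_mul, coeff_X_mul]
    rcases eq_or_lt_of_le hk with h | h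
    · obtain rfl : n = j := by omega
      rw [hP, coeff_orthoPoly_self]; ring
    · rw [(degree_lt_iff_coeff_zero _ _).1 hdD j (by omega), hP,
        coeff_orthoPoly_of_lt α β t (show n + 1 < j + 1 by omega)]; ring
  have e1 := hL _ hdX
  have e2 : originMoment α β t 0 (P * D) = 0 :=
    originMoment_orthoPoly_mul_of_degree_lt hα hβ ht.le hdD
  have e3 := originMoment_orthoPoly_mul hα hβ ht.le (n := n) (g := D)
    (natDegree_le_of_degree_lt_succ hdD)
  have e4 : originMoment α β t 0 (Q * (X * D)) =
      -(D.coeff n * originMoment α β t 1 (P * P)) := by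
    have r1 : Q * (X * D - C (D.coeff n) * P) = Q * (X * D) - D.coeff n • (P * Q) := by
      rw [smul_eq_C_mul]; ring
    have r2 : P * (X * D - C (D.coeff n) * P) = X * (P * D) - D.coeff n • (P * P) := by
      rw [smul_eq_C_mul]; ring
    rw [r1, r2, map_sub, map_sub, map_smul, map_smul, hLQ, originMoment_succ_X_mul, e2,
      smul_eq_mul, smul_eq_mul] at e1
    linarith
  have e5 : originMoment α β t 0 (D * D) = 0 := by
    have r : D * D = t • (Q * (X * D)) - ρ • (P * D) + b • (orthoPoly α β t n * D) := by
      nth_rewrite 1 [hD]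
      simp only [smul_eq_C_mul]; ring
    rw [r, map_add, map_sub, map_smul, map_smul, map_smul, e2, e3, e4]
    simp only [smul_eq_mul]
    have : b * normSq n α β t = SFun (n + 1) α β t * normSq (n + 1) α β t := by
      rw [hb]; field_simp
    linear_combination D.coeff n * (this + hS)
  have hD0 : D = 0 := by
    by_contra h
    exact (originMoment_mul_self_pos hα hβ (Or.inr ⟨ht.le, zero_le_one⟩) h).ne' e5
  linear_combination hD.symm.trans hD0

end Evolution

/-- The Riccati equation satisfied by the normalized moment `SFun`. -/
theorem hasDerivAt_SFun {α β t : ℝ} (hα : 0 < α) (hβ : 0 < β) (ht : 0 < t) (n : ℕ) :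
    HasDerivAt (SFun (n + 1) α β)
      ((2 * RFun (n + 1) α β t * rStar (n + 1) α β t - 2 * SFun (n + 1) α β t * rFun n α β t
        + SFun (n + 1) α β t * (RFun (n + 1) α β t - β) - t * RFun (n + 1) α β t) / t) t := by
  obtain ⟨Q, hQ⟩ := exists_hasPolyDerivAt_orthoPoly hα hβ ht (n + 1)
  have hn := (normSq_pos hα hβ ht.le n).ne'
  have hn1 := (normSq_pos hα hβ ht.le (n + 1)).ne'
  have ht0 := ht.ne'
  have hdeg := natDegree_le_of_degree_lt_succ (degree_orthoPoly_deriv_lt hQ)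
  have hQ0 := congrArg (fun p => coeff p 1) (X_mul_orthoPoly_deriv hα hβ ht hQ)
  simp only [coeff_sub, coeff_C_mul, coeff_X_mul _ 0] at hQ0
  have hI := (hQ.mul hQ).originMoment hα hβ ht 1
  rw [mul_comm Q, map_add, originMoment_one_orthoPoly_mul_of_le hα hβ ht.le (hdeg.trans n.le_succ)]
    at hI
  have hder := ((hasDerivAt_id t).div (hasDerivAt_normSq hα hβ ht (n + 1)) hn1).mul hI
  refine hder.congr_deriv ?_
  have hP := (natDegree_orthoPoly α β t (n + 1)).le
  have hq := (natDegree_orthoPoly α β t n).le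
  have hRS := RFun_eq_SFun_add hα hβ ht.le (n + 1)
  have h1 := rStar_mul_normSq hα hβ ht.le n
  have h4 := SFun_mul_normSq hα hβ ht.le (n + 1)
  have h5 := rFun_mul_normSq_eq_originMoment hα hβ ht.le n
  have h8 := RFun_mul_normSq_eq_originMoment hα hβ ht.le (n + 1)
  rw [originMoment_one_orthoPoly_mul_of_le hα hβ ht.le (hq.trans (by omega))] at h1
  rw [originMoment_one_orthoPoly_mul_of_le hα hβ ht.le hP] at h4
  rw [originMoment_one_orthoPoly_mul_of_le hα hβ ht.le (hq.trans (by omega)),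
    originMoment_two_orthoPoly_mul_of_le hα hβ ht.le (hq.trans (by omega))] at h5
  rw [originMoment_one_orthoPoly_mul_of_le hα hβ ht.le hP,
    originMoment_two_orthoPoly_mul_of_le hα hβ ht.le (hP.trans (by omega))] at h8
  simp only [id_eq, Pi.div_apply, one_add_one_eq_two]
  rw [originMoment_one_orthoPoly_mul_of_le hα hβ ht.le hP,
    originMoment_two_orthoPoly_mul_of_le hα hβ ht.le (hP.trans (by omega))]
  generalize RFun (n + 1) α β t = R at *
  generalize SFun (n + 1) α β t = S at *
  generalize rStar (n + 1) α β t = ρ at *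
  generalize rFun n α β t = r at *
  generalize (orthoPoly α β t (n + 1)).coeff 0 = p at *
  generalize (orthoPoly α β t (n + 1)).coeff 1 = p1 at *
  generalize (orthoPoly α β t n).coeff 0 = q at *
  generalize (orthoPoly α β t n).coeff 1 = q1 at *
  generalize originMoment α β t 1 (orthoPoly α β t (n + 1)) = e at *
  generalize originMoment α β t 2 (orthoPoly α β t (n + 1)) = e2 at *
  generalize normSq (n + 1) α β t = h at *
  generalize normSq n α β t = k at *
  generalize Q.coeff 0 = c at *
  -- All quantities are written through the coefficients of x⁰ and x¹ and the moments e, e2 of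
  -- P_{n+1}; the Riccati equation is then an identity of rational functions, up to R - S =
  -- 2n+3+α+β.
  have hc : c = (ρ * p1 - h / k * S * q1) / t := by
    rw [eq_div_iff ht0]; linear_combination hQ0
  have hS : S = t * (p * e) / h := by rw [eq_div_iff hn1]; linear_combination h4
  have hρ : ρ = t * (q * e) / k := by rw [eq_div_iff hn]; linear_combination h1
  have hr : r = (α * (q * e) + t * (q * e2 + q1 * e)) / k + (n + 1) := by
    rw [← sub_eq_iff_eq_add, eq_div_iff hn]; linear_combination h5
  have hR : R = (α * (p * e) + t * (p * e2 + p1 * e)) / h := by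
    rw [eq_div_iff hn1]; linear_combination h8
  have key : R * ρ - S * (r - (n + 1)) = (t * e / h) * (t * c) := by
    rw [hc, hr, hR, hρ, hS]; field_simp; ring
  have e1 : (1 * h - t * -(S * h / t)) / h ^ 2 * (p * e) = (1 + S) * S / t := by
    rw [hS]; field_simp; ring
  have e3 : t / h * (p * e2 + p1 * e) = R - α * S / t := by
    rw [hR, hS]; field_simp; ring
  have e4 : t / h * (c * e + c * e) = 2 * (R * ρ - S * (r - (n + 1))) / t := by
    rw [key]; field_simp; ring
  rw [e1, mul_sub, e3, e4]
  push_cast at hRS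
  field_simp
  rw [hRS]; ring

/-! ### The Hankel determinant and its logarithmic derivative. -/

/-- The unit lower triangular matrix A of coefficients of the P_j diagonalizes the moment matrix M:
A M Aᵀ = diag(h_j). -/
theorem hankelDet_eq_prod {α β t : ℝ} (hα : 0 < α) (hβ : 0 < β) (ht : 0 ≤ t) (n : ℕ) :
    hankelDet n α β t = ∏ j ∈ Finset.range n, normSq j α β t := by
  let A : Matrix (Fin n) (Fin n) ℝ := Matrix.of fun j k => (orthoPoly α β t j).coeff k
  let M : Matrix (Fin n) (Fin n) ℝ := Matrix.of fun j k =>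
    ∫ x in (0 : ℝ)..1, x ^ ((j : ℕ) + (k : ℕ)) * weight α β t x
  have hA : A.det = 1 := by
    rw [Matrix.det_of_isLowerTriangular]
    · simp [A]
    · intro i j hij
      exact coeff_orthoPoly_of_lt _ _ _ hij
  have hsum : ∀ (j : Fin n) (g : ℝ[X]), originMoment α β t 0 (orthoPoly α β t j * g) =
      ∑ k : Fin n, (orthoPoly α β t j).coeff k * originMoment α β t 0 (X ^ (k : ℕ) * g) := by
    intro j g
    have hd : (orthoPoly α β t j).natDegree ≤ n - 1 := by
      rw [natDegree_orthoPoly]; have := j.2; omega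
    have := linearMap_eq_sum (originMoment α β t 0 ∘ₗ LinearMap.mulRight ℝ g) _ hd
    simp only [LinearMap.comp_apply, LinearMap.mulRight_apply] at this
    rw [this, show n - 1 + 1 = n by have := j.2; omega, Finset.sum_range]
  have hM : A * M * A.transpose = Matrix.diagonal fun j : Fin n => normSq j α β t := by
    ext i j
    have h1 : (A * M * A.transpose) i j =
        originMoment α β t 0 (orthoPoly α β t i * orthoPoly α β t j) := by
      rw [hsum i, Matrix.mul_assoc, Matrix.mul_apply]
      refine Finset.sum_congr rfl fun k _ => ?_
      rw [mul_comm (X ^ (k : ℕ)), hsum j, Matrix.mul_apply]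
      congr 1
      refine Finset.sum_congr rfl fun l _ => ?_
      rw [mul_comm, ← pow_add, originMoment_X_pow]
      simp [A, M, add_comm]
    rw [h1, Matrix.diagonal_apply]
    split_ifs with h
    · rw [h, normSq_eq hα hβ ht]
    · rcases lt_or_gt_of_ne (fun e => h (Fin.ext e) : (i : ℕ) ≠ j) with h | h
      · rw [mul_comm]; exact originMoment_orthoPoly_mul_of_lt hα hβ ht h
      · exact originMoment_orthoPoly_mul_of_lt hα hβ ht h
  have := congrArg Matrix.det hM
  rw [Matrix.det_mul, Matrix.det_mul, Matrix.det_transpose, hA, Matrix.det_diagonal, one_mul,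
    mul_one] at this
  rw [Finset.prod_range, ← this]
  rfl

theorem hankelDet_pos {α β t : ℝ} (hα : 0 < α) (hβ : 0 < β) (ht : 0 ≤ t) (n : ℕ) :
    0 < hankelDet n α β t := by
  rw [hankelDet_eq_prod hα hβ ht]
  exact Finset.prod_pos fun j _ => normSq_pos hα hβ ht j

theorem continuousOn_hankelDet {α β : ℝ} (hα : 0 < α) (hβ : 0 < β) (n : ℕ) :
    ContinuousOn (hankelDet n α β) (Ici 0) :=
  (continuousOn_finsetProd (Finset.range n) fun j _ => continuousOn_normSq hα hβ j).congr
    fun _ hs => hankelDet_eq_prod hα hβ hs n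

theorem hasDerivAt_log_hankelDet {α β t : ℝ} (hα : 0 < α) (hβ : 0 < β) (ht : 0 < t) (n : ℕ) :
    HasDerivAt (fun s => Real.log (hankelDet n α β s / hankelDet n α β 0))
      (-(∑ j ∈ Finset.range n, SFun j α β t) / t) t := by
  have h : HasDerivAt (fun s => ∑ j ∈ Finset.range n, Real.log (normSq j α β s)
      - Real.log (hankelDet n α β 0)) (-(∑ j ∈ Finset.range n, SFun j α β t) / t) t := by
    refine HasDerivAt.sub_const _ ?_
    rw [← Finset.sum_neg_distrib, Finset.sum_div]
    refine HasDerivAt.fun_sum fun j _ => ?_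
    have hj := (normSq_pos hα hβ ht.le j).ne'
    refine ((hasDerivAt_normSq hα hβ ht j).log hj).congr_deriv ?_
    field_simp
  refine h.congr_of_eventuallyEq ?_
  filter_upwards [Ioi_mem_nhds ht] with s hs
  have hs : 0 ≤ s := le_of_lt hs
  rw [Real.log_div (hankelDet_pos hα hβ hs n).ne' (hankelDet_pos hα hβ le_rfl n).ne',
    hankelDet_eq_prod hα hβ hs, Real.log_prod fun j _ => (normSq_pos hα hβ hs j).ne']

theorem differentiableAt_hankelDet {α β t : ℝ} (hα : 0 < α) (hβ : 0 < β) (ht : 0 < t) (n : ℕ) :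
    DifferentiableAt ℝ (hankelDet n α β) t := by
  have h : DifferentiableAt ℝ (fun s => ∏ j ∈ Finset.range n, normSq j α β s) t :=
    DifferentiableAt.fun_finsetProd fun j _ => (hasDerivAt_normSq hα hβ ht j).differentiableAt
  refine h.congr_of_eventuallyEq ?_
  filter_upwards [Ioi_mem_nhds ht] with s hs using hankelDet_eq_prod hα hβ (le_of_lt hs) n

theorem HFun_eq_neg_sum {α β t : ℝ} (hα : 0 < α) (hβ : 0 < β) (ht : 0 < t) (n : ℕ) :
    HFun n α β t = -∑ j ∈ Finset.range n, SFun j α β t := by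
  rw [HFun, (hasDerivAt_log_hankelDet hα hβ ht n).deriv, mul_div_cancel₀ _ ht.ne']

theorem tendsto_HFun {α β : ℝ} (hα : 0 < α) (hβ : 0 < β) (n : ℕ) :
    Tendsto (HFun n α β) (𝓝[>] 0) (𝓝 0) := by
  have h : Tendsto (fun t => -∑ j ∈ Finset.range n, SFun j α β t) (𝓝[>] 0)
      (𝓝 (-∑ j ∈ Finset.range n, 0)) :=
    (tendsto_finsetSum _ fun j _ => tendsto_SFun hα hβ j).neg
  rw [Finset.sum_const_zero, neg_zero] at h
  refine h.congr' ?_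
  filter_upwards [self_mem_nhdsWithin] with t ht using (HFun_eq_neg_sum hα hβ ht n).symm

theorem HFun_eq_rStar_sub_rFun {α β t : ℝ} (hα : 0 < α) (hβ : 0 < β) (ht : 0 < t) (n : ℕ) :
    HFun (n + 1) α β t = (2 * (n + 1 : ℕ) + α + β) * (rStar (n + 1) α β t - rFun n α β t)
      + (n + 1 : ℕ) * ((n + 1 : ℕ) + α - t) := by
  rw [HFun_eq_neg_sum hα hβ ht, sum_SFun hα hβ ht.le, coeff_X_mul, rStar_sub_rFun hα hβ ht.le,
    neg_neg]

theorem intervalIntegrable_HFun_div {α β t : ℝ} (hα : 0 < α) (hβ : 0 < β) (ht : 0 < t) (n : ℕ) :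
    IntervalIntegrable (fun s => HFun n α β s / s) volume 0 t ∧
      hankelDet n α β t = hankelDet n α β 0 * Real.exp (∫ s in (0 : ℝ)..t, HFun n α β s / s) := by
  have h0 := hankelDet_pos hα hβ le_rfl n
  have hc : ContinuousOn (fun s => Real.log (hankelDet n α β s / hankelDet n α β 0)) (Icc 0 t) :=
    (((continuousOn_hankelDet hα hβ n).mono Icc_subset_Ici_self).div_const _).log
      fun s hs => (div_pos (hankelDet_pos hα hβ hs.1 n) h0).ne'
  have hd : ∀ s ∈ Ioo 0 t, HasDerivAt
      (fun s => Real.log (hankelDet n α β s / hankelDet n α β 0)) (HFun n α β s / s) s := by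
    intro s hs
    rw [HFun_eq_neg_sum hα hβ hs.1]
    exact hasDerivAt_log_hankelDet hα hβ hs.1 n
  have hi : IntervalIntegrable (fun s => HFun n α β s / s) volume 0 t := by
    -- Integrability up to 0 needs no estimate: -H_n/s = ∑ S_j/s is nonnegative and is the
    -- derivative of a function continuous on [0, t].
    have := intervalIntegral.integrableOn_deriv_of_nonneg hc.neg (fun s hs => (hd s hs).neg)
      fun s hs => by
        rw [HFun_eq_neg_sum hα hβ hs.1, neg_div, neg_neg]
        exact div_nonneg (Finset.sum_nonneg fun j _ => (SFun_pos hα hβ hs.1 j).le) hs.1.le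
    rw [intervalIntegrable_iff_integrableOn_Ioc_of_le ht.le]
    exact integrable_neg_iff.1 this
  refine ⟨hi, ?_⟩
  rw [intervalIntegral.integral_eq_sub_of_hasDerivAt_of_le ht.le hc hd hi, div_self h0.ne',
    Real.log_one, sub_zero, Real.exp_log (div_pos (hankelDet_pos hα hβ ht.le n) h0),
    mul_div_cancel₀ _ h0.ne']

/-! ### Elimination of the lower-index quantities, and the derivative of r_n^*. -/

theorem rStar_quadratic_relation {α β t : ℝ} (hα : 0 < α) (hβ : 0 < β) (ht : 0 < t) (n : ℕ) :
    (2 * rStar (n + 1) α β t - t) * (rFun n α β t - (n + 1 : ℕ)) - α * rStar (n + 1) α β t =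
      (rStar (n + 1) α β t ^ 2 - t * rStar (n + 1) α β t) * RFun (n + 1) α β t / SFun (n + 1) α β t
      + (rFun n α β t ^ 2 + β * rFun n α β t) * SFun (n + 1) α β t / RFun (n + 1) α β t := by
  have hn := (normSq_pos hα hβ ht.le n).ne'
  have hS := SFun_pos hα hβ ht (n + 1)
  have hRS := RFun_eq_SFun_add hα hβ ht.le (n + 1)
  have hR : RFun (n + 1) α β t ≠ 0 := by rw [hRS]; positivity
  have a := rStar_mul_rStar_sub hα hβ ht.le n
  have b := rFun_mul_rFun_add hα hβ ht.le n
  have c := two_mul_rStar_sub_mul hα hβ ht.le n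
  apply mul_right_cancel₀ hn
  push_cast
  rw [c]
  have hS := hS.ne'
  field_simp
  linear_combination (-RFun (n + 1) α β t ^ 2) * a - SFun (n + 1) α β t ^ 2 * b

/-- `β_n = h_n / h_{n-1}` in terms of `r_n^*` and the subleading coefficient of `P_n`. -/
theorem normSq_div_normSq {α β t : ℝ} (hα : 0 < α) (hβ : 0 < β) (ht : 0 ≤ t) (n : ℕ) :
    (2 * (n + 1 : ℕ) + 1 + α + β) * (2 * n + 1 + α + β)
        * (normSq (n + 1) α β t / normSq n α β t) =
      (orthoPoly α β t (n + 1)).coeff n ^ 2 - t * (orthoPoly α β t (n + 1)).coeff n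
      - t * (n + 1 : ℕ) - β * (orthoPoly α β t (n + 1)).coeff n
      + (2 * (n + 1 : ℕ) + α + β) * rStar (n + 1) α β t := by
  have hn := (normSq_pos hα hβ ht n).ne'
  have a := rStar_mul_rStar_sub hα hβ ht n
  have b := rFun_mul_rFun_add hα hβ ht n
  have c := two_mul_rStar_sub_mul hα hβ ht n
  rw [RFun_eq_SFun_add hα hβ ht n, RFun_eq_SFun_add hα hβ ht (n + 1)] at b c
  rw [← rStar_sub_rFun hα hβ ht]
  field_simp
  push_cast at *
  -- Since R - S is an explicit constant at both indices, its product over the two indices expands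
  -- into exactly the combinations in a, b and c.
  linear_combination c - a - b

theorem hasDerivAt_coeff_orthoPoly {α β t : ℝ} (hα : 0 < α) (hβ : 0 < β) (ht : 0 < t) (n : ℕ) :
    HasDerivAt (fun s => (orthoPoly α β s (n + 1)).coeff n) (rStar (n + 1) α β t / t) t := by
  obtain ⟨Q, hQ⟩ := exists_hasPolyDerivAt_orthoPoly hα hβ ht (n + 1)
  refine (hQ.2 n).congr_deriv ?_
  rw [← mul_coeff_orthoPoly_deriv hα hβ ht hQ, mul_div_cancel_left₀ _ ht.ne']

/-- `normSq_div_normSq` is solved for r^* and differentiated, using t (ln(h_{n+1}/h_n))' = S_n -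
S_{n+1} and the derivative r^*/t of the subleading coefficient. -/
theorem exists_hasDerivAt_rStar {α β t : ℝ} (hα : 0 < α) (hβ : 0 < β) (ht : 0 < t) (n : ℕ) :
    ∃ ρ', HasDerivAt (rStar (n + 1) α β) ρ' t ∧
      (2 * (n + 1 : ℕ) + α + β) * (t * ρ') =
        (2 * (n + 1 : ℕ) + 1 + α + β) * ((2 * n + 1 + α + β)
          * (normSq (n + 1) α β t / normSq n α β t) * (SFun n α β t - SFun (n + 1) α β t))
        - 2 * (rStar (n + 1) α β t - rFun n α β t) * rStar (n + 1) α β t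
        + t * (rStar (n + 1) α β t - rFun n α β t) + t * rStar (n + 1) α β t + t * (n + 1 : ℕ)
        + β * rStar (n + 1) α β t := by
  have hn := (normSq_pos hα hβ ht.le n).ne'
  have ht0 := ht.ne'
  have hν : (2 * (n + 1 : ℕ) + α + β : ℝ) ≠ 0 := by positivity
  have hp := hasDerivAt_coeff_orthoPoly hα hβ ht n
  have hY := (hasDerivAt_normSq hα hβ ht (n + 1)).div (hasDerivAt_normSq hα hβ ht n) hn
  have hd := (((((hY.const_mul ((2 * (n + 1 : ℕ) + 1 + α + β) * (2 * n + 1 + α + β))).sub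
    (hp.pow 2)).add ((hasDerivAt_id t).mul hp)).add
    ((hasDerivAt_id t).mul_const ((n + 1 : ℕ) : ℝ))).add (hp.const_mul β)).div_const
    (2 * (n + 1 : ℕ) + α + β)
  refine ⟨_, hd.congr_of_eventuallyEq ?_, ?_⟩
  · filter_upwards [Ioi_mem_nhds ht] with s hs
    have := normSq_div_normSq hα hβ (le_of_lt hs) n
    rw [eq_div_iff hν]
    simp only [Pi.add_apply, Pi.sub_apply, Pi.mul_apply, Pi.pow_apply, Pi.div_apply, id_eq]
    linear_combination -this
  · rw [rStar_sub_rFun hα hβ ht.le]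
    simp only [id_eq]
    field_simp
    ring

/-! ### Pure algebra: from the Riccati system to the closed formulas. -/

/-- After clearing denominators the quadratic terms of E form the square of G = ρR - rS, and for
given G what remains is linear in ρ. -/
theorem rStar_eq_of_relation {n α β t S R ρ r : ℝ} (hS : S ≠ 0) (hR : R ≠ 0)
    (hν : 2 * n + α + β ≠ 0)
    (E : (2 * ρ - t) * (r - n) - α * ρ = (ρ ^ 2 - t * ρ) * R / S + (r ^ 2 + β * r) * S / R) :
    ρ = (β * S * (ρ * R - r * S) + t * R * (ρ * R - r * S) + n * t * R * S - (ρ * R - r * S) ^ 2)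
      / ((2 * n + α + β) * R * S) := by
  rw [eq_div_iff (by positivity)]
  field_simp at E
  linear_combination -E

/-- Here W = t R', Y = h_n/h_{n-1} and X = Y S_{n-1}. The hypotheses make every quantity rational in
R, G, t and the parameters, so P_V for y = R/N becomes an identity of rational functions. -/
theorem painleve_of_riccati {n α β t S R ρ r G ν N X Y S' ρ' r' W' W y : ℝ} (hS : S ≠ 0)
    (hR : R ≠ 0) (hν : ν = 2 * n + α + β) (hN : N = 2 * n + 1 + α + β) (hν0 : ν ≠ 0) (hN0 : N ≠ 0)
    (hSR : R = S + N) (hr : r = (ρ * R - G) / S)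
    (hρ : ρ = (β * S * G + t * R * G + n * t * R * S - G ^ 2) / (ν * R * S))
    (hX : X = (ρ ^ 2 - t * ρ) / S) (hY : (N - 2) * Y = (r ^ 2 + β * r) / R - X)
    (hW : W = 2 * G + S * (R - β) - t * R)
    (hS' : t * S' = W)
    (hρ' : ν * (t * ρ') = N * ((N - 2) * X - S * ((N - 2) * Y)) - 2 * (ρ - r) * ρ + t * (ρ - r)
      + t * ρ + t * n + β * ρ)
    (hr' : t * r' = t * ρ' - ρ)
    (hW' : W' = 2 * S' * ρ + 2 * R * ρ' - 2 * S' * r - 2 * S * r' + S' * (R - β) + S * S' - R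
      - t * S')
    (hy : y = R / N) :
    t * W' / N = (1 / (2 * y) + 1 / (y - 1)) * (W / N) ^ 2
      + (y - 1) ^ 2 * (N ^ 2 / 2 * y - β ^ 2 / 2 / y) + α * t * y
      - t ^ 2 * y * (y + 1) / (2 * (y - 1)) := by
  have e1 : t * W' = 2 * W * (ρ - r) + 2 * N * (t * ρ') + 2 * S * ρ + W * (R - β) + S * W - t * R
      - t * W := by
    rw [hW']
    linear_combination (2 * (ρ - r) + (R - β) + S - t) * hS' + (-2 * S) * hr'
      + 2 * (t * ρ') * hSR
  have e2 : t * ρ' = (N * ((N - 2) * X - S * ((N - 2) * Y)) - 2 * (ρ - r) * ρ + t * (ρ - r)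
      + t * ρ + t * n + β * ρ) / ν := by
    field_simp; linear_combination hρ'
  rw [hY, hX] at e2
  rw [e1, e2, hy, hW]
  have e3 : R / N - 1 = S / N := by field_simp; linear_combination hSR
  have hn : n = (ν - α - β) / 2 := by linarith
  rw [e3, hr, hρ]
  field_simp
  subst hn
  have : N = ν + 1 := by linarith
  rw [hSR, this]
  ring

theorem HExpr_of_riccati {n : ℕ} {α β t S R ρ r ν N W u v : ℝ} (ht : t ≠ 0) (hS : S ≠ 0)
    (hR : R ≠ 0) (hν : ν = 2 * n + α + β) (hN : N = 2 * n + 1 + α + β) (hν0 : ν ≠ 0) (hN0 : N ≠ 0)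
    (hSR : R = S + N)
    (hρ : ρ = (β * S * (ρ * R - r * S) + t * R * (ρ * R - r * S) + n * t * R * S
      - (ρ * R - r * S) ^ 2) / (ν * R * S))
    (hW : W = 2 * (ρ * R - r * S) + S * (R - β) - t * R)
    (hu : u = R / N) (hv : v = W / N / t) :
    HExpr n α β t u v = ν * (ρ - r) + n * (n + α - t) := by
  have e0 : ν * (ρ - r) = ν * ((ρ * R - r * S - N * ρ) / S) := by
    -- Only R - S = N is used: it removes r in favour of G and ρ.
    field_simp; linear_combination (-ρ) * hSR
  rw [e0]
  generalize ρ * R - r * S = G at *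
  have e3 : u - 1 = S / N := by rw [hu]; field_simp; linear_combination hSR
  unfold HExpr
  rw [hρ, e3, hv, hu, hW]
  have hN' : N = ν + 1 := by linarith
  have hα : α = ν - β - 2 * n := by linarith
  field_simp
  rw [hSR, hN', hα]
  ring

theorem rStarExpr_of_riccati {n : ℕ} {α β t S R ρ r ν N W u v : ℝ} (ht : t ≠ 0)
    (hν : ν = 2 * n + α + β) (hN : N = 2 * n + 1 + α + β) (hν0 : ν ≠ 0) (hN0 : N ≠ 0)
    (hSR : R = S + N) (hW : W = 2 * (ρ * R - r * S) + S * (R - β) - t * R)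
    (hu : u = R / N) (hv : v = W / N / t)
    (hF : HExpr n α β t u v = ν * (ρ - r) + n * (n + α - t)) :
    rStarExpr n α β t u v = ρ := by
  unfold rStarExpr
  rw [hF, hv, hu, ← hN, ← hν, hW]
  field_simp
  rw [hSR]; ring

/-! ### The Painlevé equation, the closed formulas and the initial data. -/

/-- The right-hand side of the Riccati equation `t R_n' = …` for `n` positive. -/
def riccatiRHS (n : ℕ) (α β t : ℝ) : ℝ :=
  2 * (rStar (n + 1) α β t * RFun (n + 1) α β t - rFun n α β t * SFun (n + 1) α β t)
    + SFun (n + 1) α β t * (RFun (n + 1) α β t - β) - t * RFun (n + 1) α β t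

section

variable {α β t : ℝ}

theorem hasDerivAt_SFun' (hα : 0 < α) (hβ : 0 < β) (ht : 0 < t) (n : ℕ) :
    HasDerivAt (SFun (n + 1) α β) (riccatiRHS n α β t / t) t := by
  refine (hasDerivAt_SFun hα hβ ht n).congr_deriv ?_
  rw [riccatiRHS]; ring

theorem hasDerivAt_RFun (hα : 0 < α) (hβ : 0 < β) (ht : 0 < t) (n : ℕ) :
    HasDerivAt (RFun (n + 1) α β) (riccatiRHS n α β t / t) t := by
  refine ((hasDerivAt_SFun' hα hβ ht n).add_const
    (2 * (n + 1 : ℕ) + 1 + α + β : ℝ)).congr_of_eventuallyEq ?_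
  filter_upwards [Ioi_mem_nhds ht] with s hs using RFun_eq_SFun_add hα hβ (le_of_lt hs) (n + 1)

theorem hasDerivAt_yFun (hα : 0 < α) (hβ : 0 < β) (ht : 0 < t) (n : ℕ) :
    HasDerivAt (yFun (n + 1) α β)
      (riccatiRHS n α β t / (2 * (n + 1 : ℕ) + 1 + α + β) / t) t :=
  ((hasDerivAt_RFun hα hβ ht n).div_const _).congr_deriv (by ring)

theorem HFun_eq_HExpr (hα : 0 < α) (hβ : 0 < β) (ht : 0 < t) (n : ℕ) :
    HFun (n + 1) α β t =
      HExpr (n + 1) α β t (yFun (n + 1) α β t) (deriv (yFun (n + 1) α β) t) := by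
  have hS := SFun_pos hα hβ ht (n + 1)
  have hRS := RFun_eq_SFun_add hα hβ ht.le (n + 1)
  rw [HFun_eq_rStar_sub_rFun hα hβ ht, (hasDerivAt_yFun hα hβ ht n).deriv]
  have hR : RFun (n + 1) α β t ≠ 0 := by rw [hRS]; positivity
  exact (HExpr_of_riccati ht.ne' hS.ne' hR rfl rfl (by positivity) (by positivity) hRS
    (rStar_eq_of_relation hS.ne' hR (by positivity) (rStar_quadratic_relation hα hβ ht n)) rfl rfl
    rfl).symm

theorem rStar_eq_rStarExpr (hα : 0 < α) (hβ : 0 < β) (ht : 0 < t) (n : ℕ) :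
    rStar (n + 1) α β t =
      rStarExpr (n + 1) α β t (yFun (n + 1) α β t) (deriv (yFun (n + 1) α β) t) := by
  refine (rStarExpr_of_riccati ht.ne' rfl rfl (by positivity) (by positivity)
    (RFun_eq_SFun_add hα hβ ht.le (n + 1)) (r := rFun n α β t) rfl rfl
    (hasDerivAt_yFun hα hβ ht n).deriv ?_).symm
  exact (HFun_eq_HExpr hα hβ ht n).symm.trans (HFun_eq_rStar_sub_rFun hα hβ ht n)

theorem solvesPV_yFun (hα : 0 < α) (hβ : 0 < β) (n : ℕ) :
    SolvesPV ((2 * (n + 1 : ℕ) + 1 + α + β) ^ 2 / 2) (-β ^ 2 / 2) α (-1 / 2)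
      (yFun (n + 1) α β) := by
  intro t ht
  have ht0 := ht.ne'
  have hn := (normSq_pos hα hβ ht.le n).ne'
  have hS := SFun_pos hα hβ ht (n + 1)
  have hRS := RFun_eq_SFun_add hα hβ ht.le (n + 1)
  have hN : (0 : ℝ) < 2 * (n + 1 : ℕ) + 1 + α + β := by positivity
  have hR : 0 < RFun (n + 1) α β t := by rw [hRS]; positivity
  have hy0 : yFun (n + 1) α β t ≠ 0 := (div_pos hR hN).ne'
  have hy1 : yFun (n + 1) α β t ≠ 1 := by
    rw [yFun, Ne, div_eq_one_iff_eq hN.ne', hRS]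
    linarith
  have hy1' := sub_ne_zero.2 hy1
  obtain ⟨ρ', hρ', hρ'_eq⟩ := exists_hasDerivAt_rStar hα hβ ht n
  have hr : HasDerivAt (rFun n α β) (ρ' - rStar (n + 1) α β t / t) t := by
    refine (hρ'.sub (hasDerivAt_coeff_orthoPoly hα hβ ht n)).congr_of_eventuallyEq ?_
    filter_upwards [Ioi_mem_nhds ht] with s hs
    have := rStar_sub_rFun hα hβ (le_of_lt hs) n
    simp only [Pi.sub_apply]
    linarith
  have hS' := hasDerivAt_SFun' hα hβ ht n
  have hR' := hasDerivAt_RFun hα hβ ht n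
  have hW' : HasDerivAt (riccatiRHS n α β) _ t :=
    ((((hρ'.mul hR').sub (hr.mul hS')).const_mul 2).add (hS'.mul (hR'.sub_const β))).sub
      ((hasDerivAt_id t).mul hR')
  have hy' : deriv (yFun (n + 1) α β) =ᶠ[𝓝 t] fun s =>
      riccatiRHS n α β s / (2 * (n + 1 : ℕ) + 1 + α + β) / s := by
    filter_upwards [Ioi_mem_nhds ht] with s hs using (hasDerivAt_yFun hα hβ hs n).deriv
  have hy'' := ((hW'.div_const (2 * (n + 1 : ℕ) + 1 + α + β)).div (hasDerivAt_id t) ht0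
    ).congr_of_eventuallyEq hy'
  refine ⟨hy0, hy1, (hasDerivAt_yFun hα hβ ht n).differentiableAt, hy''.differentiableAt, ?_⟩
  rw [hy''.deriv, (hasDerivAt_yFun hα hβ ht n).deriv]
  have hrel := rStar_eq_of_relation hS.ne' hR.ne' (by positivity)
    (rStar_quadratic_relation hα hβ ht n)
  have ha := rStar_mul_rStar_sub hα hβ ht.le n
  have hb := rFun_mul_rFun_add hα hβ ht.le n
  have hRS' := RFun_eq_SFun_add hα hβ ht.le n
  have key := painleve_of_riccati (n := (n + 1 : ℕ)) (α := α) (β := β) (t := t)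
    (X := normSq (n + 1) α β t / normSq n α β t * SFun n α β t)
    (Y := normSq (n + 1) α β t / normSq n α β t)
    (r := rFun n α β t) (G := rStar (n + 1) α β t * RFun (n + 1) α β t
      - rFun n α β t * SFun (n + 1) α β t)
    (S' := riccatiRHS n α β t / t) (r' := ρ' - rStar (n + 1) α β t / t) (ρ' := ρ')
    (W := riccatiRHS n α β t)
    hS.ne' hR.ne' rfl rfl (by positivity) hN.ne' hRS
    (by rw [eq_div_iff hS.ne']; ring) hrel
    (by have := hS.ne'; field_simp; linear_combination -ha)
    (by
      rw [hRS'] at hb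
      have := hR.ne'
      field_simp
      push_cast
      linear_combination -hb)
    rfl (mul_div_cancel₀ _ ht0)
    (by rw [hρ'_eq]; push_cast; ring)
    (by rw [mul_sub, mul_div_cancel₀ _ ht0]) rfl
    (y := yFun (n + 1) α β t) rfl
  simp only [id_eq]
  generalize yFun (n + 1) α β t = y at *
  generalize (2 * (n + 1 : ℕ) + 1 + α + β : ℝ) = N at *
  generalize riccatiRHS n α β t = W at *
  -- From t y' = W/N one has t² y'' = t W'/N - t y', so the relation for W' is P_V multiplied by t².
  have expand : ∀ W' : ℝ, t * W' / N = (1 / (2 * y) + 1 / (y - 1)) * (W / N) ^ 2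
      + (y - 1) ^ 2 * (N ^ 2 / 2 * y - β ^ 2 / 2 / y) + α * t * y
      - t ^ 2 * y * (y + 1) / (2 * (y - 1)) →
      (W' / N * t - W / N * 1) / t ^ 2 = (1 / (2 * y) + 1 / (y - 1)) * (W / N / t) ^ 2
      - W / N / t / t + (y - 1) ^ 2 / t ^ 2 * (N ^ 2 / 2 * y + -β ^ 2 / 2 / y) + α * y / t
      + -1 / 2 * y * (y + 1) / (y - 1) := by
    intro W' h
    rw [show W' / N * t = t * W' / N by ring, h]
    field_simp
    ring
  refine expand _ ?_
  rw [← key]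
  ring

theorem yFun_zero (hα : 0 < α) (hβ : 0 < β) (n : ℕ) : yFun n α β 0 = 1 := by
  have hN : (2 * n + 1 + α + β : ℝ) ≠ 0 := by positivity
  rw [yFun, RFun_eq_SFun_add hα hβ le_rfl, SFun, zero_div, zero_mul, zero_add, div_self hN]

theorem tendsto_yFun (hα : 0 < α) (hβ : 0 < β) (n : ℕ) :
    Tendsto (yFun n α β) (𝓝[>] 0) (𝓝 1) := by
  have hN : (2 * n + 1 + α + β : ℝ) ≠ 0 := by positivity
  have h := ((tendsto_SFun hα hβ n).add_const (2 * n + 1 + α + β : ℝ)).div_const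
    (2 * n + 1 + α + β)
  rw [zero_add, div_self hN] at h
  refine h.congr' ?_
  filter_upwards [self_mem_nhdsWithin] with t ht
  rw [yFun, RFun_eq_SFun_add hα hβ (le_of_lt ht)]

end

end

end PollaczekJacobi

open PollaczekJacobi
theorem lemma1 (n : ℕ) (hn : 1 ≤ n) (α β : ℝ) (hα : 0 < α) (hβ : 0 < β) :
    (∀ t : ℝ, 0 ≤ t → 0 < hankelDet n α β t) ∧
    (∀ t : ℝ, 0 < t → DifferentiableAt ℝ (hankelDet n α β) t) ∧
    SolvesPV ((2 * n + 1 + α + β) ^ 2 / 2) (-β ^ 2 / 2) α (-1 / 2) (yFun n α β) ∧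
    yFun n α β 0 = 1 ∧ Tendsto (yFun n α β) (𝓝[>] 0) (𝓝 1) ∧
    (∀ t : ℝ, 0 < t →
      HFun n α β t = HExpr n α β t (yFun n α β t) (deriv (yFun n α β) t)) ∧
    HFun n α β 0 = 0 ∧ Tendsto (HFun n α β) (𝓝[>] 0) (𝓝 0) ∧
    (∀ t : ℝ, 0 < t →
      rStar n α β t = rStarExpr n α β t (yFun n α β t) (deriv (yFun n α β) t)) ∧
    (∀ t : ℝ, 0 < t →
      IntervalIntegrable (fun s => HExpr n α β s (yFun n α β s) (deriv (yFun n α β) s) / s)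
        MeasureTheory.volume 0 t ∧
      hankelDet n α β t = hankelDet n α β 0 *
        Real.exp (∫ s in (0 : ℝ)..t,
          HExpr n α β s (yFun n α β s) (deriv (yFun n α β) s) / s)) := by
  -- The shift turns the index n - 1 occurring in r_n^* into m.
  obtain ⟨m, rfl⟩ : ∃ m, n = m + 1 := ⟨n - 1, by omega⟩
  refine ⟨fun t ht => hankelDet_pos hα hβ ht _, fun t ht => differentiableAt_hankelDet hα hβ ht _,
    solvesPV_yFun hα hβ m, yFun_zero hα hβ _, tendsto_yFun hα hβ _,
    fun t ht => HFun_eq_HExpr hα hβ ht m, by simp [HFun], tendsto_HFun hα hβ _,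
    fun t ht => rStar_eq_rStarExpr hα hβ ht m, fun t ht => ?_⟩
  obtain ⟨hi, hD⟩ := intervalIntegrable_HFun_div hα hβ ht (m + 1)
  have he : Set.EqOn (fun s => HFun (m + 1) α β s / s) (fun s => HExpr (m + 1) α β s
      (yFun (m + 1) α β s) (deriv (yFun (m + 1) α β) s) / s) (Set.uIoc 0 t) := by
    intro s hs
    rw [Set.uIoc_of_le ht.le] at hs
    simp only [HFun_eq_HExpr hα hβ hs.1]
  refine ⟨hi.congr he, ?_⟩
  rw [hD, intervalIntegral.integral_congr_ae (Eventually.of_forall fun s hs => he hs)]
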